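/- Let $\mathbf t=(t_1,t_2,\dots)$, $p_r=r\,t_r$, and let $\rho$ be a parameter. Define operators $B_m$ ($m\in\mathbb Z$) on polynomials in $\mathbf t$ by $$\sum_{m\in\mathbb Z}B_m u^m=\exp\Big(\sum_{n\ge1}(1-\rho^n)t_nu^n\Big)\exp\Big(-\sum_{n\ge1}(1-\rho^n)t_n^{\perp}u^{-n}\Big),\qquad (1-\rho^n)\,t_n^\perp=\frac1n\frac{\partial}{\partial t_n},$$ where, for $\rho$ an indeterminate, $t_n^\perp$ is the adjoint of multiplication by $t_n$ for the scalar product in which the monomials $t_\lambda=\prod_i t_{\lambda_i}$ ($\lambda$ a partition) are orthogonal with $\langle t_\lambda,t_\lambda\rangle=\dfrac{\prod_k k^{m_k(\lambda)}m_k(\lambda)!}{\prod_i(1-\rho^{\lambda_i})\,\prod_i\lambda_i^2}$. For $\lambda=(\lambda_1,\dots,\lambda_l)\in\mathbb Z^l$ let $Q_\lambda=Q_\lambda(\mathbf t;\rho)=B_{\lambda_1}\cdots B_{\lambda_l}\cdot1$ be the Hall–Littlewood polynomial. For a partition $\mu=(\mu_1\ge\dots\ge\mu_{l(\mu)}>0)$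 put $$c_\mu(\rho)=\frac{\rho^{n(\mu)}\phi_{l(\mu)-1}(\rho^{-1})}{b_\mu(\rho)},\quad n(\mu)=\sum_{i}(i-1)\mu_i,\quad \phi_k(x)=\prod_{i=1}^k(1-x^i),\quad b_\mu(\rho)=\prod_{i\ge1}\phi_{m_i(\mu)}(\rho),$$ where $m_i(\mu)=\#\{j:\mu_j=i\}$. Then for all integers $r\ge1$, $l\ge0$ and all $\lambda\in\mathbb Z^l$, $$p_r\,Q_\lambda=\sum_{i=1}^{l}Q_{\lambda+r\epsilon_i}+\sum_{\mu\text{ a partition},\ |\mu|=r}c_\mu(\rho)\,Q_{(\lambda,\mu)},$$ where $\lambda+r\epsilon_i$ is $\lambda$ with $r$ added to its $i$-th entry and $(\lambda,\mu)$ denotes concatenation. This identity holds over $\mathbb C(\rho)$ with $\rho$ an indeterminate, and also at every complex value of $\rho$ with $\rho^r\neq1$; for such a value every rational function $c_\mu$ with $|\mu|=r$ has no pole there, and $c_\mu(\rho)$ denotes its value (so removable singularities are removed, e.g. at $\rho=0$). -/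

import Mathlib

namespace HallLittlewood

noncomputable section

open MvPolynomial

/-- The polynomial ring `K[t₁, t₂, …]`; the variable `t_n` is `X n` for `n : ℕ+`. -/
abbrev Lam (K : Type*) [Field K] : Type _ := MvPolynomial ℕ+ K

section Pairing

variable {K : Type*} [Field K]

/-- `⟨t_s, t_s⟩ = z_s(ρ) / (∏ parts)²`, where the exponent vector `s` records the multiplicities
`m_k = s k` of a partition and `z_s(ρ) = (∏ k^{m_k} m_k!) / ∏ (1 - ρ^k)^{m_k}`. -/
def pairingDiag (ρ : K) (s : ℕ+ →₀ ℕ) : K :=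
  s.prod fun k m =>
    (((k : ℕ) : K) ^ m * (m.factorial : K)) / (1 - ρ ^ (k : ℕ)) ^ m / (((k : ℕ) : K) ^ m) ^ 2

/-- The bilinear scalar product on `K[t]` for which the monomials are orthogonal with
`⟨t_s, t_s⟩ = pairingDiag ρ s`. -/
def pairing (ρ : K) : Lam K →ₗ[K] Lam K →ₗ[K] K :=
  (basisMonomials ℕ+ K).constr K fun s => pairingDiag ρ s • lcoeff K s

end Pairing

section Operators

variable {K : Type*} [Field K]

/-- The operator `(1 - ρ^n) t_n^⊥ = (1/n) ∂/∂t_n = ∂/∂p_n`; it makes sense for every value of `ρ`.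
That it is `1 - ρ^n` times the adjoint of multiplication by `t_n` is `pairing_adjoint` below. -/
def annih (n : ℕ+) : Module.End K (Lam K) :=
  (((n : ℕ) : K)⁻¹) • (pderiv n : Derivation K (Lam K) (Lam K)).toLinearMap

theorem pairing_monomial (ρ : K) (s : ℕ+ →₀ ℕ) (w : Lam K) :
    pairing ρ (monomial s 1) w = pairingDiag ρ s * coeff s w := by
  have h := (basisMonomials ℕ+ K).constr_basis K (fun s => pairingDiag ρ s • lcoeff K s) s
  rw [coe_basisMonomials] at h
  simp only [pairing, h]
  rfl

theorem pairingDiag_add_single [CharZero K] (ρ : K) (r : ℕ+) (hr : ρ ^ (r : ℕ) ≠ 1)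
    (s : ℕ+ →₀ ℕ) :
    (1 - ρ ^ (r : ℕ)) * pairingDiag ρ (s + Finsupp.single r 1) =
      pairingDiag ρ s * (((r : ℕ) : K)⁻¹ * ((s r : K) + 1)) := by
  classical
  have h1 : (1 - ρ ^ (r : ℕ)) ≠ 0 := sub_ne_zero.mpr (Ne.symm hr)
  have h2 : ((r : ℕ) : K) ≠ 0 := by exact_mod_cast r.ne_zero
  unfold pairingDiag
  have hs : s = s.erase r + Finsupp.single r (s r) := (Finsupp.erase_add_single r s).symm
  have key : ∀ m : ℕ, (s.erase r + Finsupp.single r m).prod (fun (k : ℕ+) m =>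
      (((k : ℕ) : K) ^ m * (m.factorial : K)) / (1 - ρ ^ (k : ℕ)) ^ m / (((k : ℕ) : K) ^ m) ^ 2)
      = (s.erase r).prod (fun (k : ℕ+) m =>
      (((k : ℕ) : K) ^ m * (m.factorial : K)) / (1 - ρ ^ (k : ℕ)) ^ m / (((k : ℕ) : K) ^ m) ^ 2)
      * ((((r : ℕ) : K) ^ m * (m.factorial : K)) / (1 - ρ ^ (r : ℕ)) ^ m /
        (((r : ℕ) : K) ^ m) ^ 2) := by
    intro m
    rw [Finsupp.prod_add_index_of_disjoint, Finsupp.prod_single_index]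
    · simp
    · rw [Finset.disjoint_left]
      intro a ha hb
      have := Finsupp.support_single_subset hb
      simp only [Finset.mem_singleton] at this
      subst this
      simp at ha
  have e1 : s + Finsupp.single r 1 = s.erase r + Finsupp.single r (s r + 1) := by
    conv_lhs => rw [hs]
    rw [add_assoc, ← Finsupp.single_add]
  rw [e1, key]
  conv_rhs => rw [hs]
  rw [key]
  simp only [Finsupp.add_apply, Finsupp.erase_same, Finsupp.single_eq_same, zero_add]
  rw [Nat.factorial_succ]
  push_cast
  field_simp
  ring

/-- `annih r` is `1 - ρ^r` times the adjoint of multiplication by `t_r`. -/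
theorem pairing_adjoint [CharZero K] (ρ : K) (r : ℕ+) (hr : ρ ^ (r : ℕ) ≠ 1) (v w : Lam K) :
    (1 - ρ ^ (r : ℕ)) * pairing ρ (X r * v) w = pairing ρ v (annih r w) := by
  induction v using MvPolynomial.induction_on' with
  | monomial s a =>
    have e : (monomial s a : Lam K) = a • monomial s 1 := by
      rw [smul_monomial, smul_eq_mul, mul_one]
    have e2 : (X r * monomial s a : Lam K) = a • monomial (s + Finsupp.single r 1) 1 := by
      rw [X, monomial_mul, smul_monomial, smul_eq_mul, mul_one, one_mul, add_comm]
    rw [e2, e]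
    simp only [map_smul, LinearMap.smul_apply, smul_eq_mul, pairing_monomial]
    have h := pairingDiag_add_single ρ r hr s
    have h3 : coeff s (annih r w) =
        ((r : ℕ) : K)⁻¹ * (coeff (s + Finsupp.single r 1) w * ((s r : K) + 1)) := by
      simp [annih, coeff_pderiv]
    rw [h3]
    linear_combination a * coeff (s + Finsupp.single r 1) w * h
  | add p q hp hq => simp only [mul_add, map_add, LinearMap.add_apply, hp, hq]

/-- The scalar product is nondegenerate for generic `ρ`, so adjoints are unique. -/
theorem pairing_nondegenerate [CharZero K] (ρ : K) (hρ : ∀ r : ℕ+, ρ ^ (r : ℕ) ≠ 1) (w : Lam K)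
    (h : ∀ v, pairing ρ v w = 0) : w = 0 := by
  ext s
  have h1 := h (monomial s 1)
  rw [pairing_monomial] at h1
  refine (mul_eq_zero.mp h1).resolve_left ?_
  refine Finset.prod_ne_zero_iff.mpr fun k _ => ?_
  have h1 : (1 - ρ ^ (k : ℕ)) ≠ 0 := sub_ne_zero.mpr (Ne.symm (hρ k))
  have h2 : ((k : ℕ) : K) ≠ 0 := by exact_mod_cast k.ne_zero
  have h3 : ((s k).factorial : K) ≠ 0 := by exact_mod_cast (s k).factorial_ne_zero
  positivity

/-- The exponential `∑_k F^k / k!` of a power series `F` without constant term, over a possibly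
noncommutative `K`-algebra (only the terms `k ≤ j` contribute to the `j`-th coefficient). -/
def psExp {A : Type*} [Ring A] [Algebra K A] (F : PowerSeries A) : PowerSeries A :=
  PowerSeries.mk fun j =>
    ∑ k ∈ Finset.range (j + 1), ((k.factorial : K)⁻¹) • PowerSeries.coeff j (F ^ k)

/-- The series `∑_{n ≥ 1} (1 - ρ^n) t_n u^n`. -/
def creationSeries (ρ : K) : PowerSeries (Lam K) :=
  PowerSeries.mk fun n => if h : 0 < n then (1 - ρ ^ n) • X ⟨n, h⟩ else 0

/-- The series `-∑_{n ≥ 1} (1 - ρ^n) t_n^⊥ v^n` in `v = u⁻¹`, with operator coefficients. -/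
def annihSeries : PowerSeries (Module.End K (Lam K)) :=
  PowerSeries.mk fun n => if h : 0 < n then -annih ⟨n, h⟩ else 0

/-- The coefficient of `u^m` in `exp (∑ (1 - ρ^n) t_n u^n)`, zero for `m < 0`. -/
def creationCoeff (ρ : K) (m : ℤ) : Lam K :=
  if 0 ≤ m then PowerSeries.coeff m.toNat (psExp (K := K) (creationSeries ρ)) else 0

/-- The coefficient of `u^{-j}` in `exp (-∑ (1 - ρ^n) t_n^⊥ u^{-n})`. -/
def annihCoeff (j : ℕ) : Module.End K (Lam K) :=
  PowerSeries.coeff j (psExp (K := K) annihSeries)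

/-- Polynomials all of whose monomials have degree `≤ d`, where `deg t_n = n`. -/
def degLE (K : Type*) [Field K] (d : ℤ) : Submodule K (Lam K) where
  carrier := {f | ∀ s, d < (s.sum fun n m => ((n : ℕ) * m : ℤ)) → coeff s f = 0}
  add_mem' := by
    intro f g hf hg s hs
    rw [coeff_add, hf s hs, hg s hs, add_zero]
  zero_mem' := by
    intro s _
    simp
  smul_mem' := by
    intro c f hf s hs
    rw [coeff_smul, hf s hs, smul_zero]

theorem annih_mem (n : ℕ+) (d : ℤ) (f : Lam K) (hf : f ∈ degLE K d) :
    annih n f ∈ degLE K (d - (n : ℕ)) := by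
  intro s hs
  have : coeff (s + Finsupp.single n 1) f = 0 := by
    apply hf
    rw [Finsupp.sum_add_index' (by simp) (by intros; push_cast; ring),
      Finsupp.sum_single_index (by simp)]
    push_cast
    linarith
  simp [annih, coeff_pderiv, this]

theorem annihSeries_pow_mem (k : ℕ) : ∀ (j : ℕ) (d : ℤ) (f : Lam K), f ∈ degLE K d →
    PowerSeries.coeff j ((annihSeries (K := K)) ^ k) f ∈ degLE K (d - j) := by
  induction k with
  | zero =>
    intro j d f hf
    rw [pow_zero, PowerSeries.coeff_one]
    split_ifs with h
    · subst h
      simpa using hf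
    · simp
  | succ k ih =>
    intro j d f hf
    rw [pow_succ, PowerSeries.coeff_mul, LinearMap.sum_apply]
    refine Submodule.sum_mem _ fun x hx => ?_
    rw [Finset.HasAntidiagonal.mem_antidiagonal] at hx
    rw [Module.End.mul_apply]
    have h1 : PowerSeries.coeff x.2 (annihSeries (K := K)) f ∈ degLE K (d - x.2) := by
      rw [annihSeries, PowerSeries.coeff_mk]
      split_ifs with h
      · rw [LinearMap.neg_apply]
        exact Submodule.neg_mem _ (annih_mem ⟨x.2, h⟩ d f hf)
      · simp
    have h2 := ih x.1 _ _ h1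
    have : d - (j : ℤ) = d - x.2 - x.1 := by
      rw [← hx]
      push_cast
      ring
    rwa [this]

theorem annihCoeff_mem (j : ℕ) (d : ℤ) (f : Lam K) (hf : f ∈ degLE K d) :
    annihCoeff j f ∈ degLE K (d - j) := by
  rw [annihCoeff, psExp, PowerSeries.coeff_mk, LinearMap.sum_apply]
  exact Submodule.sum_mem _ fun k _ =>
    Submodule.smul_mem _ _ (annihSeries_pow_mem k j d f hf)

theorem exists_mem_degLE (f : Lam K) : ∃ d, f ∈ degLE K d := by
  induction f using MvPolynomial.induction_on' with
  | monomial s a =>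
    classical
    refine ⟨s.sum fun n m => ((n : ℕ) * m : ℤ), fun t ht => ?_⟩
    rw [coeff_monomial, if_neg]
    rintro rfl
    exact lt_irrefl _ ht
  | add p q hp hq =>
    obtain ⟨a, ha⟩ := hp
    obtain ⟨b, hb⟩ := hq
    refine ⟨max a b, Submodule.add_mem _ (fun s hs => ha s ?_) (fun s hs => hb s ?_)⟩
    · exact lt_of_le_of_lt (le_max_left _ _) hs
    · exact lt_of_le_of_lt (le_max_right _ _) hs

/-- On a given polynomial only finitely many coefficients of the annihilation part act nontrivially,
so the sum defining `B` is finite. -/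
theorem annihCoeff_finite (f : Lam K) : (Function.support fun j : ℕ => annihCoeff j f).Finite := by
  obtain ⟨d, hd⟩ := exists_mem_degLE f
  refine (Set.finite_le_nat d.toNat).subset fun j hj => ?_
  by_contra hlt
  apply hj
  ext s
  refine annihCoeff_mem j d f hd s ?_
  have h0 : (0 : ℤ) ≤ s.sum fun n m => ((n : ℕ) * m : ℤ) :=
    Finset.sum_nonneg fun _ _ => by positivity
  simp only [Set.mem_ofPred_eq, not_le] at hlt
  omega

theorem B_support_finite (ρ : K) (m : ℤ) (f : Lam K) :
    (Function.support fun j : ℕ => creationCoeff ρ (m + j) * annihCoeff j f).Finite := by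
  refine (annihCoeff_finite f).subset fun j hj h => hj ?_
  simp only at h ⊢
  rw [h, mul_zero]

/-- The vertex operator `B_m`: the coefficient of `u^m` in
`B(u) = exp (∑ (1 - ρ^n) t_n u^n) exp (-∑ (1 - ρ^n) t_n^⊥ u^{-n})`. -/
def B (ρ : K) (m : ℤ) : Module.End K (Lam K) where
  toFun f := ∑ᶠ j : ℕ, creationCoeff ρ (m + j) * annihCoeff j f
  map_add' f g := by
    rw [← finsum_add_distrib (B_support_finite ρ m f) (B_support_finite ρ m g)]
    simp only [map_add, mul_add]
  map_smul' c f := by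
    simp only [map_smul, mul_smul_comm, RingHom.id_apply]
    exact (smul_finsum' c (B_support_finite ρ m f)).symm

/-- The Hall-Littlewood polynomial `Q_λ(t; ρ) = B_{λ₁} ⋯ B_{λ_l} · 1` of an integer sequence. -/
def Q (ρ : K) (lam : List ℤ) : Lam K :=
  (lam.map (B ρ)).prod 1

end Operators

section Coefficients

variable {K : Type*} [Field K] {r : ℕ}

/-- The parts `μ₁ ≥ μ₂ ≥ ⋯` of a partition. -/
def partsList (μ : r.Partition) : List ℕ := μ.parts.sort (· ≥ ·)

/-- `n(μ) = ∑ (i - 1) μ_i`. -/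
def nStat (μ : r.Partition) : ℕ :=
  ∑ i : Fin (partsList μ).length, (i : ℕ) * (partsList μ).get i

/-- `φ_k(x) = ∏_{i=1}^k (1 - x^i)`. -/
def phi (k : ℕ) (x : K) : K := ∏ i ∈ Finset.Icc 1 k, (1 - x ^ i)

/-- `b_μ(x) = ∏_{i ≥ 1} φ_{m_i(μ)}(x)`, with `m_i(μ)` the number of parts equal to `i`. -/
def bStat (μ : r.Partition) (x : K) : K := ∏ i ∈ Finset.Icc 1 r, phi (μ.parts.count i) x

/-- `c_μ(x) = x^{n(μ)} φ_{l(μ)-1}(x⁻¹) / b_μ(x)`. -/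
def c (μ : r.Partition) (x : K) : K :=
  x ^ nStat μ * phi ((partsList μ).length - 1) x⁻¹ / bStat μ x

end Coefficients

/-- The power sum `p_r = r t_r`. -/
def p {K : Type*} [Field K] (r : ℕ+) : Lam K := ((r : ℕ) : K) • X r

/-- `c_μ` as a rational function of the indeterminate `ρ`. -/
def cGeneric {r : ℕ} (μ : r.Partition) : RatFunc ℂ := c μ RatFunc.X

end

end HallLittlewood

/-!
Multiplication by `p_r` commutes with the creation part of `B(u)`, and the annihilation part shifts
`p_r` by `-u^{-r}`; hence `p_r B_m = B_m p_r + B_{m+r}` (`p_mul_B`). Moving `p_r` through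
`B_{λ₁} ⋯ B_{λ_l} · 1` yields the terms `Q_{λ + r ε_i}` and `B_{λ₁} ⋯ B_{λ_l} · p_r`, so everything
reduces to the expansion `p_r = ∑_{|μ| = r} c_μ Q_μ` (`p_eq_sum_Q`).

For the expansion let `ρ` be generic and put `G(y) = exp (∑ (1 - y^n) t_n z^n)`. The
series `U_0 = ∑_{m ≥ 0} z^m B_m` multiplies `G(y)` by `exp (∑ (1 - ρ^n) t_n (y z)^n)`, that is,
`U_0 G(y) = G(ρ y)` (`sum_B_creationCoeff`); since `G(1) = 1`, this gives
`G(ρ^k) = U_0^k · 1`. More generally let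
`U_a = ∑_{n ≥ 0} z^n B_{a+n}`, so that `U_a = B_a + z U_{a+1}`. The exchange relations of the `B_m`
(`B_exchange`, read off from the operator product expansion `B_comp`) add up to the single relation
`U_a U_{a+1} = ρ U_{a+1} U_a` (`truncB_exchange`), and the `q`-binomial theorem (`qBinomial`)
turns it into
`U_a^l / φ_l = ∑_{i + k = l} ρ^{i(i-1)/2} (z^i U_{a+1}^i / φ_i) (B_a^k / φ_k)`.

This is used twice. With `a = 0` and `B_0 · 1 = 1` it expresses `G(ρ^k)` through the `U_1^l · 1`;
both sides are polynomials in `y = ρ^k`, so the expression holds for an indeterminate `y`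
(`creationPoly_eq`), and minus its derivative at `y = 1` is
`p_r = ∑_l φ_{l-1}(ρ⁻¹) ρ^{l(l-1)/2} [z^{r-l}] U_1^l / φ_l · 1` (`p_eq_sum_truncBPow`). Iterated
over `a = 1, 2, …`, it splits off the parts equal to `1`, then those equal to `2`, and so on, and
writes `U_1^l / φ_l` as a sum over partitions with `l` parts (`truncBPow_eq_sum`). The powers of `ρ`
collected on the way make up `ρ^{n(μ)}`, and the factors `φ_k` make up `b_μ`.

For a complex value of `ρ` the identity over `ℂ(ρ)` is specialized coefficient by coefficient. The
`Q_λ` have coefficients polynomial in `ρ`, and `c_μ` is regular wherever `ρ^r ≠ 1`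
(`cGeneric_mem_regularAt`).

Exponentials are handled through the differential equation `u E' = (u F') E` of `E = exp F`.
-/

namespace HallLittlewood

noncomputable section

open MvPolynomial
open Finset.HasAntidiagonal (antidiagonal mem_antidiagonal)

/-! ### Exponentials of power series -/

section Exp

variable {A : Type*} [Ring A]

/-- The Euler operator `u d/du` on power series over a possibly noncommutative ring. -/
def euler (F : PowerSeries A) : PowerSeries A :=
  PowerSeries.mk fun n => (n : A) * PowerSeries.coeff n F

theorem coeff_euler (F : PowerSeries A) (n : ℕ) :
    PowerSeries.coeff n (euler F) = (n : A) * PowerSeries.coeff n F := PowerSeries.coeff_mk _ _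

theorem euler_mul (F G : PowerSeries A) : euler (F * G) = euler F * G + F * euler G := by
  ext n
  simp only [coeff_euler, map_add, PowerSeries.coeff_mul, Finset.mul_sum, ← Finset.sum_add_distrib]
  refine Finset.sum_congr rfl fun x hx => ?_
  rw [← mem_antidiagonal.mp hx, ← mul_assoc (PowerSeries.coeff x.1 F),
    ← (Nat.cast_commute x.2 (PowerSeries.coeff x.1 F)).eq]
  push_cast
  noncomm_ring

theorem euler_pow_succ (F : PowerSeries A) (h : Commute F (euler F)) (k : ℕ) :
    euler (F ^ (k + 1)) = (k + 1) • (euler F * F ^ k) := by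
  induction k with
  | zero => simp
  | succ k ih =>
    rw [pow_succ' F (k + 1), euler_mul, ih, mul_smul_comm, ← mul_assoc, h.eq, mul_assoc,
      ← pow_succ', succ_nsmul' _ (k + 1)]

theorem coeff_pow_eq_zero (F : PowerSeries A) (h0 : PowerSeries.coeff 0 F = 0) :
    ∀ (k j : ℕ), j < k → PowerSeries.coeff j (F ^ k) = 0 := by
  intro k
  induction k with
  | zero => intro j hj; omega
  | succ k ih =>
    intro j hj
    rw [pow_succ, PowerSeries.coeff_mul]
    refine Finset.sum_eq_zero fun x hx => ?_
    have hx := mem_antidiagonal.mp hx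
    rcases Nat.eq_zero_or_pos x.2 with h | h
    · rw [h, h0, mul_zero]
    · rw [ih x.1 (by omega), zero_mul]

variable {K : Type*} [Field K] [Algebra K A]

theorem coeff_psExp_eq (F : PowerSeries A) (h0 : PowerSeries.coeff 0 F = 0) {j N : ℕ}
    (hN : j ≤ N) : PowerSeries.coeff j (psExp (K := K) F) =
      ∑ k ∈ Finset.range (N + 1), ((k.factorial : K)⁻¹) • PowerSeries.coeff j (F ^ k) := by
  rw [psExp, PowerSeries.coeff_mk]
  refine Finset.sum_subset (Finset.range_mono (by omega)) fun k _ hk => ?_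
  rw [coeff_pow_eq_zero F h0 k j (by simpa using hk), smul_zero]

/-- The differential equation `u E' = (u F') E` of `E = exp F`, read off on coefficients. It is used
in place of the series itself to compute with exponentials. -/
theorem coeff_psExp_rec [CharZero K] (F : PowerSeries A) (h0 : PowerSeries.coeff 0 F = 0)
    (hc : ∀ a b, Commute (PowerSeries.coeff a F) (PowerSeries.coeff b F)) (j : ℕ) :
    (j : K) • PowerSeries.coeff j (psExp (K := K) F) =
      ∑ x ∈ antidiagonal j,
        (x.1 : K) • (PowerSeries.coeff x.1 F * PowerSeries.coeff x.2 (psExp (K := K) F)) := by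
  have hcom : Commute F (euler F) := by
    ext n
    simp only [PowerSeries.coeff_mul, coeff_euler]
    rw [← Finset.Nat.sum_antidiagonal_swap]
    refine Finset.sum_congr rfl fun x _ => ?_
    simp only [Prod.fst_swap, Prod.snd_swap]
    rw [← mul_assoc, ← (Nat.cast_commute x.1 (PowerSeries.coeff x.2 F)).eq, mul_assoc, mul_assoc,
      (hc x.2 x.1).eq]
  have hpow : ∀ k, (j : K) • PowerSeries.coeff j (F ^ (k + 1)) = ((k + 1 : ℕ) : K) •
      ∑ x ∈ antidiagonal j,
        (x.1 : K) • (PowerSeries.coeff x.1 F * PowerSeries.coeff x.2 (F ^ k)) := by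
    intro k
    have h := congrArg (PowerSeries.coeff j) (euler_pow_succ F hcom k)
    rw [coeff_euler, map_nsmul, PowerSeries.coeff_mul] at h
    rw [Nat.cast_smul_eq_nsmul, Nat.cast_smul_eq_nsmul, nsmul_eq_mul, h]
    congr 1
    refine Finset.sum_congr rfl fun x _ => ?_
    rw [coeff_euler, Nat.cast_smul_eq_nsmul, nsmul_eq_mul, mul_assoc]
  have hE : ∀ x ∈ antidiagonal j,
      (x.1 : K) • (PowerSeries.coeff x.1 F * PowerSeries.coeff x.2 (psExp (K := K) F)) =
      ∑ k ∈ Finset.range (j + 1), ((k.factorial : K)⁻¹) •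
        ((x.1 : K) • (PowerSeries.coeff x.1 F * PowerSeries.coeff x.2 (F ^ k))) := by
    intro x hx
    have hx := mem_antidiagonal.mp hx
    rw [coeff_psExp_eq (K := K) F h0 (show x.2 ≤ j by omega), Finset.mul_sum, Finset.smul_sum]
    refine Finset.sum_congr rfl fun k _ => ?_
    rw [mul_smul_comm, smul_comm]
  rw [Finset.sum_congr rfl hE, Finset.sum_comm, coeff_psExp_eq (K := K) F h0 (Nat.le_succ j),
    Finset.sum_range_succ', smul_add, Finset.smul_sum]
  have hz : (j : K) • ((Nat.factorial 0 : K)⁻¹) • PowerSeries.coeff j (F ^ 0) = 0 := by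
    rcases Nat.eq_zero_or_pos j with h | h
    · simp [h]
    · simp [PowerSeries.coeff_one, h.ne']
  rw [hz, add_zero]
  refine Finset.sum_congr rfl fun k _ => ?_
  rw [smul_comm, hpow, smul_smul, ← Finset.smul_sum]
  congr 1
  rw [Nat.factorial_succ]
  have : ((k + 1 : ℕ) : K) ≠ 0 := by exact_mod_cast k.succ_ne_zero
  have : (k.factorial : K) ≠ 0 := by exact_mod_cast k.factorial_ne_zero
  push_cast at *
  field_simp

theorem euler_psExp [CharZero K] (F : PowerSeries A) (h0 : PowerSeries.coeff 0 F = 0)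
    (hc : ∀ a b, Commute (PowerSeries.coeff a F) (PowerSeries.coeff b F)) :
    euler (psExp (K := K) F) = euler F * psExp (K := K) F := by
  ext n
  have h := coeff_psExp_rec (K := K) F h0 hc n
  rw [Nat.cast_smul_eq_nsmul, nsmul_eq_mul] at h
  rw [coeff_euler, h, PowerSeries.coeff_mul]
  refine Finset.sum_congr rfl fun x _ => ?_
  rw [coeff_euler, Nat.cast_smul_eq_nsmul, nsmul_eq_mul, mul_assoc]

/-- A first-order equation `u E' = G E` has at most one solution with given constant term. -/
theorem eq_of_euler_eq [CharZero K] {G E E' : PowerSeries A} (hG : PowerSeries.coeff 0 G = 0)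
    (hE : euler E = G * E) (hE' : euler E' = G * E')
    (h0 : PowerSeries.coeff 0 E = PowerSeries.coeff 0 E') : E = E' := by
  ext n
  induction n using Nat.strong_induction_on with
  | _ n ih =>
    rcases Nat.eq_zero_or_pos n with h | h
    · rw [h, h0]
    have h1 := congrArg (PowerSeries.coeff n) hE
    have h2 := congrArg (PowerSeries.coeff n) hE'
    rw [coeff_euler, PowerSeries.coeff_mul] at h1 h2
    have hn : (n : K) ≠ 0 := by exact_mod_cast h.ne'
    refine smul_right_injective A hn ?_
    simp only
    rw [Nat.cast_smul_eq_nsmul, Nat.cast_smul_eq_nsmul, nsmul_eq_mul, nsmul_eq_mul, h1, h2]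
    refine Finset.sum_congr rfl fun x hx => ?_
    rcases Nat.eq_zero_or_pos x.1 with hx1 | hx1
    · rw [hx1, hG, zero_mul, zero_mul]
    · have := mem_antidiagonal.mp hx
      rw [ih x.2 (by omega)]

end Exp

/-! ### The annihilation operators -/

section Annih

variable {K : Type*} [Field K]

theorem annih_mul (n : ℕ+) (f g : Lam K) : annih n (f * g) = annih n f * g + f * annih n g := by
  simp only [annih, LinearMap.smul_apply, Derivation.coeFn_coe,
    Derivation.leibniz, smul_eq_mul, smul_add, Algebra.mul_smul_comm]
  rw [add_comm, mul_comm g]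
  simp [Algebra.smul_mul_assoc]

theorem annih_X (n m : ℕ+) :
    annih n (X m : Lam K) = if n = m then C ((n : ℕ) : K)⁻¹ else 0 := by
  classical
  simp only [annih, LinearMap.smul_apply, Derivation.coeFn_coe,
    pderiv_X, Pi.single_apply]
  by_cases h : n = m
  · subst h
    simp [smul_eq_C_mul]
  · simp [h, Ne.symm h]

theorem annih_commute (n m : ℕ+) : Commute (annih n : Module.End K (Lam K)) (annih m) := by
  refine LinearMap.ext fun f => ?_
  simp only [Module.End.mul_apply, annih, LinearMap.smul_apply, 
    Derivation.coeFn_coe, map_smul]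
  rw [smul_comm]
  congr 2
  have h : ⁅(pderiv n : Derivation K (Lam K) (Lam K)), pderiv m⁆ =
      (0 : Derivation K (Lam K) (Lam K)) := by
    refine MvPolynomial.derivation_ext fun i => ?_
    classical
    simp [Derivation.commutator_apply, pderiv_X, Pi.single_apply, apply_ite]
  have h2 := DFunLike.congr_fun h f
  rw [Derivation.commutator_apply] at h2
  exact sub_eq_zero.mp h2

/-- The derivation `-n (1 - ρ^n) t_n^⊥`, extended by zero to `n = 0`. -/
def annihD (n : ℕ) : Module.End K (Lam K) := (n : K) • PowerSeries.coeff n annihSeries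

theorem coeff_annihSeries (n : ℕ+) :
    PowerSeries.coeff (n : ℕ) (annihSeries (K := K)) = -annih n := by
  rw [annihSeries, PowerSeries.coeff_mk, dif_pos n.pos]
  rfl

theorem coeff_zero_annihSeries : PowerSeries.coeff 0 (annihSeries (K := K)) = 0 := by
  rw [annihSeries, PowerSeries.coeff_mk, dif_neg (lt_irrefl _)]

theorem annihSeries_commute (a b : ℕ) : Commute (PowerSeries.coeff a (annihSeries (K := K)))
    (PowerSeries.coeff b annihSeries) := by
  simp only [annihSeries, PowerSeries.coeff_mk]
  split_ifs
  · exact ((annih_commute (K := K) _ _).neg_left).neg_right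
  all_goals simp

theorem annihD_mul (n : ℕ) (f g : Lam K) :
    annihD n (f * g) = annihD n f * g + f * annihD n g := by
  rcases Nat.eq_zero_or_pos n with h | h
  · simp [annihD, h]
  · lift n to ℕ+ using h
    simp only [annihD, coeff_annihSeries, LinearMap.smul_apply, LinearMap.neg_apply, annih_mul]
    rw [smul_mul_assoc, mul_smul_comm, ← smul_add]
    ring_nf

variable [CharZero K]

theorem annihCoeff_rec (j : ℕ) (f : Lam K) :
    (j : K) • annihCoeff j f =
      ∑ x ∈ antidiagonal j, annihD x.1 (annihCoeff x.2 f) := by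
  have h := LinearMap.congr_fun
    (coeff_psExp_rec (K := K) annihSeries coeff_zero_annihSeries annihSeries_commute j) f
  rw [LinearMap.smul_apply] at h
  rw [annihCoeff, h, LinearMap.sum_apply]
  rfl

omit [CharZero K] in
theorem annihCoeff_zero (f : Lam K) : annihCoeff 0 f = f := by
  simp [annihCoeff, psExp]

/-- The exponential of a derivation is multiplicative. -/
theorem annihCoeff_mul (j : ℕ) (f g : Lam K) : annihCoeff j (f * g) =
    ∑ x ∈ antidiagonal j, annihCoeff x.1 f * annihCoeff x.2 g := by
  induction j using Nat.strong_induction_on with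
  | _ j ih =>
    rcases Nat.eq_zero_or_pos j with h | h
    · subst h
      simp [annihCoeff_zero]
    have hj : (j : K) ≠ 0 := by exact_mod_cast h.ne'
    refine smul_right_injective _ hj ?_
    simp only
    rw [annihCoeff_rec, Finset.smul_sum]
    have e1 : ∀ x ∈ antidiagonal j, (j : K) • (annihCoeff x.1 f * annihCoeff x.2 g) =
        (∑ y ∈ antidiagonal x.1, annihD y.1 (annihCoeff y.2 f) * annihCoeff x.2 g) +
        ∑ y ∈ antidiagonal x.2, annihCoeff x.1 f * annihD y.1 (annihCoeff y.2 g) := by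
      intro x hx
      rw [← Finset.sum_mul, ← Finset.mul_sum, ← annihCoeff_rec, ← annihCoeff_rec, smul_mul_assoc,
        mul_smul_comm, ← add_smul, ← mem_antidiagonal.mp hx]
      push_cast
      rfl
    have e2 : ∀ x ∈ antidiagonal j, annihD x.1 (annihCoeff x.2 (f * g)) =
        (∑ y ∈ antidiagonal x.2, annihD x.1 (annihCoeff y.1 f) * annihCoeff y.2 g) +
        ∑ y ∈ antidiagonal x.2, annihCoeff y.1 f * annihD x.1 (annihCoeff y.2 g) := by
      intro x hx
      rcases Nat.eq_zero_or_pos x.1 with h0 | h0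
      · simp [h0, annihD]
      · have := mem_antidiagonal.mp hx
        rw [ih x.2 (by omega), map_sum, ← Finset.sum_add_distrib]
        exact Finset.sum_congr rfl fun y _ => annihD_mul _ _ _
    rw [Finset.sum_congr rfl e1, Finset.sum_congr rfl e2, Finset.sum_add_distrib,
      Finset.sum_add_distrib]
    congr 1
    · simp only [Finset.sum_sigma']
      refine Finset.sum_nbij' (fun x => ⟨(x.1.1 + x.2.1, x.2.2), (x.1.1, x.2.1)⟩)
        (fun x => ⟨(x.2.1, x.2.2 + x.1.2), (x.2.2, x.1.2)⟩) ?_ ?_ ?_ ?_ ?_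
      all_goals
        rintro ⟨⟨a, b⟩, ⟨c, d⟩⟩ h
        simp only [Finset.mem_sigma, mem_antidiagonal] at h ⊢
        try grind
    · simp only [Finset.sum_sigma']
      refine Finset.sum_nbij' (fun x => ⟨(x.2.1, x.1.1 + x.2.2), (x.1.1, x.2.2)⟩)
        (fun x => ⟨(x.2.1, x.1.1 + x.2.2), (x.1.1, x.2.2)⟩) ?_ ?_ ?_ ?_ ?_
      all_goals
        rintro ⟨⟨a, b⟩, ⟨c, d⟩⟩ h
        simp only [Finset.mem_sigma, mem_antidiagonal] at h ⊢
        try grind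

end Annih

/-! ### The creation series and the action of annihilation on it -/

section Creation

variable {K : Type*} [Field K]

/-- The variable `t_n`, extended by `t_0 = 0`. -/
def tvar (n : ℕ) : Lam K := if h : 0 < n then X ⟨n, h⟩ else 0

theorem coeff_creationSeries (y : K) (n : ℕ) :
    PowerSeries.coeff n (creationSeries y) = (1 - y ^ n) • tvar n := by
  rw [creationSeries, PowerSeries.coeff_mk, tvar]
  split_ifs <;> simp

theorem coeff_zero_creationSeries (y : K) : PowerSeries.coeff 0 (creationSeries y) = 0 := by
  simp [coeff_creationSeries]

theorem creationCoeff_natCast (y : K) (n : ℕ) :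
    creationCoeff y n = PowerSeries.coeff n (psExp (K := K) (creationSeries y)) := by
  simp [creationCoeff]

theorem creationCoeff_of_neg (y : K) {m : ℤ} (h : m < 0) : creationCoeff y m = 0 :=
  if_neg (not_le.mpr h)

theorem creationCoeff_zero (y : K) : creationCoeff y 0 = 1 := by
  simp [creationCoeff, psExp]

theorem annihD_zero : annihD 0 = (0 : Module.End K (Lam K)) := by
  simp [annihD]

theorem annihD_C (n : ℕ) (a : K) : annihD n (C a : Lam K) = 0 := by
  rcases Nat.eq_zero_or_pos n with h | h
  · rw [h, annihD_zero, LinearMap.zero_apply]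
  · lift n to ℕ+ using h
    simp [annihD, coeff_annihSeries, annih]

variable [CharZero K]

theorem annihD_tvar (a n : ℕ) (ha : 0 < a) :
    annihD a (tvar n : Lam K) = if n = a then -1 else 0 := by
  lift a to ℕ+ using ha
  rcases Nat.eq_zero_or_pos n with h | h
  · subst h
    rw [tvar, dif_neg (lt_irrefl _), map_zero, if_neg a.pos.ne]
  · lift n to ℕ+ using h
    have h2 : ((a : ℕ) : K) ≠ 0 := by exact_mod_cast a.ne_zero
    rw [tvar, dif_pos n.pos, annihD, coeff_annihSeries, LinearMap.smul_apply,
      LinearMap.neg_apply]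
    change ((a : ℕ) : K) • -annih a (X n) = _
    rw [annih_X]
    by_cases e : a = n
    · subst e
      rw [if_pos rfl, if_pos rfl, smul_neg, smul_eq_C_mul, ← C_mul, mul_inv_cancel₀ h2, C_1]
    · rw [if_neg e, if_neg (fun h => e (PNat.coe_injective h).symm), neg_zero, smul_zero]

theorem creationCoeff_rec (y : K) {m : ℤ} {N : ℕ} (hN : m ≤ N) :
    (m : K) • creationCoeff y m = ∑ n ∈ Finset.range (N + 1),
      ((n : K) * (1 - y ^ n)) • (tvar n * creationCoeff y (m - n)) := by
  rcases lt_or_ge m 0 with h | h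
  · rw [creationCoeff_of_neg y h, smul_zero]
    refine (Finset.sum_eq_zero fun n _ => ?_).symm
    rw [creationCoeff_of_neg y (by omega), mul_zero, smul_zero]
  lift m to ℕ using h
  have h1 := coeff_psExp_rec (K := K) (creationSeries y) (coeff_zero_creationSeries y)
    (fun _ _ => Commute.all _ _) m
  rw [creationCoeff_natCast, Int.cast_natCast, h1,
    Finset.Nat.sum_antidiagonal_eq_sum_range_succ_mk]
  refine (Finset.sum_congr rfl fun n hn => ?_).trans
    (Finset.sum_subset (Finset.range_mono (show m + 1 ≤ N + 1 by omega)) fun n _ hn => ?_)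
  · have : n ≤ m := by simpa [Nat.lt_succ_iff] using hn
    simp only
    rw [← Nat.cast_sub this, creationCoeff_natCast, coeff_creationSeries, smul_mul_assoc, smul_smul]
  · rw [creationCoeff_of_neg y (by simp at hn; omega), mul_zero, smul_zero]

theorem annihD_creationCoeff (y : K) (a : ℕ) (m : ℤ) :
    annihD a (creationCoeff y m) = -((1 - y ^ a) • creationCoeff y (m - a)) := by
  rcases Nat.eq_zero_or_pos a with ha | ha
  · simp [ha, annihD_zero]
  rcases lt_or_ge m 0 with h | h
  · rw [creationCoeff_of_neg y h, creationCoeff_of_neg y (by omega)]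
    simp
  lift m to ℕ using h
  induction m using Nat.strong_induction_on with
  | _ m ih =>
    rcases Nat.eq_zero_or_pos m with h | h
    · subst h
      rw [Nat.cast_zero, creationCoeff_zero, creationCoeff_of_neg y (by omega), ← C_1, annihD_C]
      simp
    have hm : ((m : ℤ) : K) ≠ 0 := by exact_mod_cast h.ne'
    refine smul_right_injective _ hm ?_
    simp only
    have key : ∀ n ∈ Finset.range (m + a + 1),
        annihD a (((n : K) * (1 - y ^ n)) • (tvar n * creationCoeff y (m - n))) =
        -((1 - y ^ a) • ((if n = a then (a : K) • creationCoeff y (m - a) else 0) +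
          ((n : K) * (1 - y ^ n)) • (tvar n * creationCoeff y (m - a - n)))) := by
      intro n _
      rcases Nat.eq_zero_or_pos n with hn | hn
      · subst hn
        simp [ha.ne]
      have e : annihD a (creationCoeff y (m - n)) =
          -((1 - y ^ a) • creationCoeff y (m - a - n)) := by
        rcases lt_or_ge (m : ℤ) n with h' | h'
        · rw [creationCoeff_of_neg y (by omega), creationCoeff_of_neg y (by omega)]
          simp
        · rw [← Nat.cast_sub (by omega), ih (m - n) (by omega), Nat.cast_sub (by omega)]
          congr 3
          ring
      rw [map_smul, annihD_mul, annihD_tvar a n ha, e]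
      split_ifs with hna
      · subst hna
        simp only [smul_eq_C_mul, map_mul, map_sub, map_pow, C_1]
        ring
      · simp only [smul_eq_C_mul, map_mul, map_sub, map_pow, C_1]
        ring
    rw [← map_smul, creationCoeff_rec y (show (m : ℤ) ≤ (m + a : ℕ) by omega), map_sum,
      Finset.sum_congr rfl key, Finset.sum_neg_distrib, ← Finset.smul_sum, Finset.sum_add_distrib,
      ← creationCoeff_rec y (show (m : ℤ) - a ≤ (m + a : ℕ) by omega),
      Finset.sum_ite_eq' , if_pos (by simp)]
    simp only [smul_eq_C_mul, map_sub, map_pow, C_1, Int.cast_sub, Int.cast_natCast]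
    ring

/-- The coefficients of `(1 - x) / (1 - y x)`. -/
def kernelCoeff (y : K) : ℕ → K
  | 0 => 1
  | n + 1 => y ^ (n + 1) - y ^ n

omit [CharZero K] in
theorem sum_kernelCoeff (y : K) (n : ℕ) :
    ∑ j ∈ Finset.range (n + 1), kernelCoeff y j = y ^ n := by
  induction n with
  | zero => simp [kernelCoeff]
  | succ n ih => rw [Finset.sum_range_succ, ih, kernelCoeff]; ring

omit [CharZero K] in
theorem kernelCoeff_rec (y : K) (n : ℕ) :
    ∑ x ∈ antidiagonal n, -((1 - y ^ x.1) * kernelCoeff y x.2) = n * kernelCoeff y n := by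
  cases n with
  | zero => simp [kernelCoeff]
  | succ n =>
    rw [Finset.Nat.sum_antidiagonal_succ']
    have e : ∀ x ∈ antidiagonal n, -((1 - y ^ x.1) * kernelCoeff y (x.2 + 1)) =
        (1 - y) * y ^ x.2 + (y - 1) * y ^ n := by
      intro x hx
      rw [← mem_antidiagonal.mp hx, kernelCoeff]
      ring
    have g := Finset.Nat.sum_antidiagonal_eq_sum_range_succ_mk (fun x : ℕ × ℕ => y ^ x.1) n
    rw [← Finset.Nat.sum_antidiagonal_swap] at g
    simp only [Prod.fst_swap] at g
    have g2 := mul_neg_geom_sum y (n + 1)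
    simp only
    rw [Finset.sum_congr rfl e, Finset.sum_add_distrib, ← Finset.mul_sum, g, g2, Finset.sum_const,
      Finset.Nat.card_antidiagonal, kernelCoeff, kernelCoeff]
    simp only [nsmul_eq_mul]
    push_cast
    ring

/-- `exp (-∑ (1 - ρ^n) t_n^⊥ v^n)` multiplies `exp (∑ (1 - y^n) t_n z^n)` by
`(1 - v z) / (1 - y v z)`. -/
theorem annihCoeff_creationCoeff (y : K) (j : ℕ) (m : ℤ) :
    annihCoeff j (creationCoeff y m) = kernelCoeff y j • creationCoeff y (m - j) := by
  induction j using Nat.strong_induction_on generalizing m with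
  | _ j ih =>
    rcases Nat.eq_zero_or_pos j with h | h
    · simp [h, annihCoeff_zero, kernelCoeff]
    have hj : (j : K) ≠ 0 := by exact_mod_cast h.ne'
    refine smul_right_injective _ hj ?_
    simp only
    rw [annihCoeff_rec, smul_smul, ← kernelCoeff_rec, Finset.sum_smul]
    refine Finset.sum_congr rfl fun x hx => ?_
    have hx := mem_antidiagonal.mp hx
    rcases Nat.eq_zero_or_pos x.1 with h0 | h0
    · simp [h0, annihD_zero]
    rw [ih x.2 (by omega), map_smul, annihD_creationCoeff, smul_neg, smul_smul, neg_smul, mul_comm,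
      sub_sub, ← hx]
    congr 3
    push_cast
    ring

/-- `exp (∑ (1 - ρ^n) t_n (y z)^n) · exp (∑ (1 - y^n) t_n z^n) = exp (∑ (1 - (ρ y)^n) t_n z^n)`. -/
theorem sum_creationCoeff_mul (ρ y : K) (r : ℕ) :
    ∑ x ∈ antidiagonal r, (y ^ x.1 • creationCoeff ρ x.1) * creationCoeff y x.2 =
      creationCoeff (ρ * y) r := by
  set E : K → PowerSeries (Lam K) := fun y => psExp (K := K) (creationSeries y) with hE
  have hEu : ∀ y, euler (E y) = euler (creationSeries y) * E y := fun y =>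
    euler_psExp (K := K) _ (coeff_zero_creationSeries y) fun _ _ => Commute.all _ _
  set E1 : PowerSeries (Lam K) := PowerSeries.mk fun n => y ^ n • PowerSeries.coeff n (E ρ) with hE1
  set G1 : PowerSeries (Lam K) :=
    PowerSeries.mk fun n => y ^ n • PowerSeries.coeff n (euler (creationSeries ρ)) with hG1
  have h1 : euler E1 = G1 * E1 := by
    ext n : 1
    have h := congrArg (PowerSeries.coeff n) (hEu ρ)
    rw [coeff_euler, PowerSeries.coeff_mul] at h
    rw [coeff_euler, PowerSeries.coeff_mul, hE1, PowerSeries.coeff_mk, mul_smul_comm, h,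
      Finset.smul_sum]
    refine Finset.sum_congr rfl fun x hx => ?_
    rw [hG1, PowerSeries.coeff_mk, PowerSeries.coeff_mk, smul_mul_smul_comm, ← pow_add,
      mem_antidiagonal.mp hx]
  have h2 : G1 + euler (creationSeries y) = euler (creationSeries (ρ * y)) := by
    ext n : 1
    simp only [map_add, hG1, PowerSeries.coeff_mk, coeff_euler, coeff_creationSeries,
      mul_smul_comm, smul_smul, ← add_smul]
    congr 1
    ring
  have h3 : E1 * E y = E (ρ * y) := by
    refine eq_of_euler_eq (K := K) (G := euler (creationSeries (ρ * y))) ?_ ?_ (hEu _) ?_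
    · simp [coeff_euler]
    · rw [euler_mul, h1, hEu, ← h2]
      ring
    · simp [hE1, hE, psExp]
  rw [creationCoeff_natCast]
  have h4 := congrArg (PowerSeries.coeff r) h3
  rw [PowerSeries.coeff_mul] at h4
  rw [← h4]
  refine Finset.sum_congr rfl fun x _ => ?_
  rw [creationCoeff_natCast, creationCoeff_natCast, hE1, PowerSeries.coeff_mk]

end Creation

/-! ### Vertex operators -/

section Vertex

variable {K : Type*} [Field K]

theorem annihCoeff_eq_zero {d : ℤ} {f : Lam K} (hf : f ∈ degLE K d) {j : ℕ} (hj : d < j) :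
    annihCoeff j f = 0 := by
  ext s
  refine annihCoeff_mem j d f hf s ?_
  have h0 : (0 : ℤ) ≤ s.sum fun n m => ((n : ℕ) * m : ℤ) :=
    Finset.sum_nonneg fun _ _ => by positivity
  omega

theorem exists_annihCoeff_bound (f : Lam K) :
    ∃ N : ℕ, ∀ j, N ≤ j → annihCoeff j f = 0 ∧ ∀ i, annihCoeff j (annihCoeff i f) = 0 := by
  obtain ⟨d, hd⟩ := exists_mem_degLE f
  refine ⟨d.toNat + 1, fun j hj => ⟨annihCoeff_eq_zero hd (by omega), fun i => ?_⟩⟩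
  exact annihCoeff_eq_zero (annihCoeff_mem i d f hd) (by omega)

theorem B_apply (ρ : K) (m : ℤ) {f : Lam K} {N : ℕ} (hN : ∀ j, N ≤ j → annihCoeff j f = 0) :
    B ρ m f = ∑ j ∈ Finset.range N, creationCoeff ρ (m + j) * annihCoeff j f := by
  change ∑ᶠ j : ℕ, creationCoeff ρ (m + j) * annihCoeff j f = _
  refine finsum_eq_sum_of_support_subset _ fun j hj => ?_
  by_contra hlt
  apply hj
  simp only
  rw [hN j (by simpa using hlt), mul_zero]

variable [CharZero K]

theorem annihCoeff_C (j : ℕ) (a : K) : annihCoeff j (C a : Lam K) = if j = 0 then C a else 0 := by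
  induction j using Nat.strong_induction_on with
  | _ j ih =>
    rcases Nat.eq_zero_or_pos j with h | h
    · simp [h, annihCoeff_zero]
    have hj : (j : K) ≠ 0 := by exact_mod_cast h.ne'
    refine smul_right_injective _ hj ?_
    simp only
    rw [annihCoeff_rec, if_neg h.ne', smul_zero]
    refine Finset.sum_eq_zero fun x hx => ?_
    have hx := mem_antidiagonal.mp hx
    rcases Nat.eq_zero_or_pos x.1 with h0 | h0
    · simp [h0, annihD_zero]
    rw [ih x.2 (by omega)]
    split_ifs
    · exact annihD_C _ _
    · exact map_zero _

theorem B_one (ρ : K) (m : ℤ) : B ρ m (1 : Lam K) = creationCoeff ρ m := by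
  rw [B_apply ρ m (N := 1) fun j hj => by
    rw [← C_1, annihCoeff_C, if_neg (by omega)]]
  simp [annihCoeff_zero]

/-- The annihilation part shifts `p_r` by `-v^r`. -/
theorem annihCoeff_p (r : ℕ+) (j : ℕ) :
    annihCoeff j (p r : Lam K) = if j = 0 then p r else if j = r then -1 else 0 := by
  have hp : (p r : Lam K) = ((r : ℕ) : K) • tvar (r : ℕ) := by
    rw [p, tvar, dif_pos r.pos]
    rfl
  rcases Nat.eq_zero_or_pos j with h | h
  · simp [h, annihCoeff_zero]
  have hj : (j : K) ≠ 0 := by exact_mod_cast h.ne'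
  rw [if_neg h.ne']
  induction j using Nat.strong_induction_on with
  | _ j ih =>
    refine smul_right_injective _ hj ?_
    simp only
    rw [annihCoeff_rec, Finset.sum_eq_single (j, 0)]
    · simp only
      rw [annihCoeff_zero, hp, map_smul, annihD_tvar _ _ h]
      by_cases e : j = r
      · simp [e]
      · simp [e, Ne.symm e]
    · rintro ⟨a, b⟩ hx hne
      have hx := mem_antidiagonal.mp hx
      simp only at hx ⊢
      rcases Nat.eq_zero_or_pos a with h0 | h0
      · simp [h0, annihD_zero]
      have hb : 0 < b := by
        rcases Nat.eq_zero_or_pos b with hb | hb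
        · simp_all
        · exact hb
      rw [ih b (by omega) hb (by exact_mod_cast hb.ne')]
      have h1 := annihD_C a (1 : K)
      rw [C_1] at h1
      split_ifs <;> simp [h1]
    · intro hx
      exact absurd (mem_antidiagonal.mpr (by simp)) hx

theorem annihCoeff_p_mul (r : ℕ+) (j : ℕ) (f : Lam K) : annihCoeff j (p r * f) =
    p r * annihCoeff j f - if (r : ℕ) ≤ j then annihCoeff (j - r) f else 0 := by
  rw [annihCoeff_mul, Finset.Nat.sum_antidiagonal_eq_sum_range_succ_mk, Finset.sum_range_succ']
  simp only [annihCoeff_p, Nat.succ_ne_zero, if_true, if_false, Nat.sub_zero]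
  rw [add_comm, sub_eq_add_neg]
  congr 1
  have hr := r.pos
  split_ifs with h
  · rw [Finset.sum_eq_single ((r : ℕ) - 1)]
    · rw [if_pos (by omega), Nat.sub_add_cancel hr, neg_one_mul]
    · intro b _ hb
      rw [if_neg (by omega), zero_mul]
    · intro hb
      simp only [Finset.mem_range] at hb
      omega
  · rw [neg_zero]
    refine Finset.sum_eq_zero fun b hb => ?_
    simp only [Finset.mem_range] at hb
    rw [if_neg (by omega), zero_mul]

/-- Multiplication by a power sum acts on the vertex operators by raising the index. -/
theorem p_mul_B (ρ : K) (r : ℕ+) (m : ℤ) (f : Lam K) :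
    p r * B ρ m f = B ρ m (p r * f) + B ρ (m + (r : ℕ)) f := by
  obtain ⟨N, hN⟩ := exists_annihCoeff_bound f
  rw [B_apply ρ m (f := f) (N := (r : ℕ) + N) fun j hj => (hN j (by omega)).1,
    B_apply ρ m (f := p r * f) (N := (r : ℕ) + N) fun j hj => by
      rw [annihCoeff_p_mul, (hN j (by omega)).1, if_pos (by omega), (hN _ (by omega)).1]
      simp,
    B_apply ρ (m + (r : ℕ)) (f := f) fun j hj => (hN j hj).1]
  simp only [annihCoeff_p_mul, mul_sub, Finset.sum_sub_distrib, Finset.mul_sum]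
  rw [Finset.sum_range_add (fun j => creationCoeff ρ (m + j) *
    if (r : ℕ) ≤ j then annihCoeff (j - r) f else 0), Finset.sum_eq_zero (s := Finset.range r)]
  · have : ∀ j : ℕ, m + ((r : ℕ) + j : ℕ) = m + (r : ℕ) + j := by intro j; push_cast; ring
    simp only [this, Nat.le_add_right, if_true, Nat.add_sub_cancel_left, zero_add]
    rw [sub_add_cancel]
    exact Finset.sum_congr rfl fun j _ => by ring
  · intro j hj
    rw [if_neg (by simpa using hj), mul_zero]

/-- `∑_{m ≥ 0} z^m B_m` sends `exp (∑ (1 - y^n) t_n z^n)` to `exp (∑ (1 - (ρ y)^n) t_n z^n)`. -/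
theorem sum_B_creationCoeff (ρ y : K) (r : ℕ) :
    ∑ x ∈ antidiagonal r, B ρ x.1 (creationCoeff y x.2) = creationCoeff (ρ * y) r := by
  have h1 : ∀ x ∈ antidiagonal r, B ρ x.1 (creationCoeff y x.2) =
      ∑ z ∈ antidiagonal x.2, kernelCoeff y z.1 •
        (creationCoeff ρ (x.1 + z.1 : ℕ) * creationCoeff y z.2) := by
    intro x _
    rw [B_apply ρ x.1 (N := x.2 + 1) fun j hj => by
      rw [annihCoeff_creationCoeff, creationCoeff_of_neg y (by omega), smul_zero],
      Finset.Nat.sum_antidiagonal_eq_sum_range_succ_mk]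
    refine Finset.sum_congr rfl fun j hj => ?_
    simp only [Finset.mem_range] at hj
    rw [annihCoeff_creationCoeff, mul_smul_comm, Nat.cast_sub (by omega)]
    push_cast
    rfl
  have h2 : ∀ x ∈ antidiagonal r, (y ^ x.1 • creationCoeff ρ x.1) * creationCoeff y x.2 =
      ∑ z ∈ antidiagonal x.1, kernelCoeff y z.2 •
        (creationCoeff ρ x.1 * creationCoeff y x.2) := by
    intro x _
    rw [← Finset.sum_smul, ← Finset.Nat.sum_antidiagonal_swap]
    simp only [Prod.snd_swap]
    rw [Finset.Nat.sum_antidiagonal_eq_sum_range_succ_mk, sum_kernelCoeff, smul_mul_assoc]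
  rw [← sum_creationCoeff_mul, Finset.sum_congr rfl h1, Finset.sum_congr rfl h2]
  simp only [Finset.sum_sigma']
  refine Finset.sum_nbij' (fun x => ⟨(x.1.1 + x.2.1, x.2.2), (x.1.1, x.2.1)⟩)
    (fun x => ⟨(x.2.1, x.2.2 + x.1.2), (x.2.2, x.1.2)⟩) ?_ ?_ ?_ ?_ ?_
  all_goals
    rintro ⟨⟨a, b⟩, ⟨c, d⟩⟩ h
    simp only [Finset.mem_sigma, mem_antidiagonal] at h ⊢
    try grind

omit [CharZero K] in
theorem annihD_comm (m n : ℕ) (f : Lam K) : annihD m (annihD n f) = annihD n (annihD m f) := by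
  have h := LinearMap.congr_fun (annihSeries_commute (K := K) m n).eq f
  simp only [Module.End.mul_apply] at h
  simp only [annihD, LinearMap.smul_apply, map_smul, h]
  rw [smul_comm]

theorem annihCoeff_annihD_comm (j n : ℕ) (f : Lam K) :
    annihCoeff j (annihD n f) = annihD n (annihCoeff j f) := by
  induction j using Nat.strong_induction_on with
  | _ j ih =>
    rcases Nat.eq_zero_or_pos j with h | h
    · simp [h, annihCoeff_zero]
    have hj : (j : K) ≠ 0 := by exact_mod_cast h.ne'
    refine smul_right_injective _ hj ?_
    simp only
    rw [annihCoeff_rec, ← map_smul, annihCoeff_rec, map_sum]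
    refine Finset.sum_congr rfl fun x hx => ?_
    have hx := mem_antidiagonal.mp hx
    rcases Nat.eq_zero_or_pos x.1 with h0 | h0
    · simp [h0, annihD_zero]
    rw [ih x.2 (by omega), annihD_comm]

theorem annihCoeff_comm (i j : ℕ) (f : Lam K) :
    annihCoeff i (annihCoeff j f) = annihCoeff j (annihCoeff i f) := by
  induction j using Nat.strong_induction_on with
  | _ j ih =>
    rcases Nat.eq_zero_or_pos j with h | h
    · simp [h, annihCoeff_zero]
    have hj : (j : K) ≠ 0 := by exact_mod_cast h.ne'
    refine smul_right_injective _ hj ?_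
    simp only
    rw [← map_smul, annihCoeff_rec, annihCoeff_rec, map_sum]
    refine Finset.sum_congr rfl fun x hx => ?_
    have hx := mem_antidiagonal.mp hx
    rcases Nat.eq_zero_or_pos x.1 with h0 | h0
    · simp [h0, annihD_zero]
    rw [annihCoeff_annihD_comm, ih x.2 (by omega)]

/-- The coefficient of `u^m v^n` in the normally ordered product `:B(u)B(v):` applied to `f`,
truncated to annihilation degrees below `N`. -/
def normalOrdered (ρ : K) (N : ℕ) (m n : ℤ) (f : Lam K) : Lam K :=
  ∑ i ∈ Finset.range N, ∑ b ∈ Finset.range N,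
    creationCoeff ρ (m + b) * creationCoeff ρ (n + i) * annihCoeff b (annihCoeff i f)

theorem normalOrdered_comm (ρ : K) (N : ℕ) (m n : ℤ) (f : Lam K) :
    normalOrdered ρ N m n f = normalOrdered ρ N n m f := by
  rw [normalOrdered, Finset.sum_comm, normalOrdered]
  refine Finset.sum_congr rfl fun i _ => Finset.sum_congr rfl fun b _ => ?_
  rw [annihCoeff_comm, mul_comm (creationCoeff ρ (m + i))]

theorem sum_range_antidiagonal {M : Type*} [AddCommMonoid M] (F : ℕ × ℕ → M) {A N T : ℕ}
    (hT : A + N ≤ T) (hF : ∀ x : ℕ × ℕ, ¬(x.1 < A ∧ x.2 < N) → F x = 0) :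
    ∑ j ∈ Finset.range T, ∑ x ∈ antidiagonal j, F x =
      ∑ a ∈ Finset.range A, ∑ b ∈ Finset.range N, F (a, b) := by
  rw [← Finset.sum_product', ← Finset.sum_fiberwise_of_maps_to (t := Finset.range T)
    (g := fun x : ℕ × ℕ => x.1 + x.2)]
  · refine Finset.sum_congr rfl fun j _ => (Finset.sum_subset (fun x hx => ?_) ?_).symm
    · simp only [Finset.mem_filter] at hx
      exact mem_antidiagonal.mpr hx.2
    · intro x hx hx2
      refine hF x fun h => hx2 ?_
      simp only [Finset.mem_filter, Finset.mem_product, Finset.mem_range]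
      exact ⟨h, mem_antidiagonal.mp hx⟩
  · intro x hx
    simp only [Finset.mem_product, Finset.mem_range] at hx ⊢
    omega

/-- The operator product expansion `B(u)B(v) = (1 - v/u) / (1 - ρ v/u) :B(u)B(v):`. -/
theorem B_comp (ρ : K) (m n : ℤ) {f : Lam K} {N A : ℕ}
    (hN : ∀ j, N ≤ j → annihCoeff j f = 0 ∧ ∀ i, annihCoeff j (annihCoeff i f) = 0)
    (hA : n + N ≤ A) : B ρ m (B ρ n f) =
      ∑ a ∈ Finset.range A, kernelCoeff ρ a • normalOrdered ρ N (m + a) (n - a) f := by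
  -- `T` bounds the annihilation degree on `B_n f`; beyond `a = A` the creation factor vanishes
  obtain ⟨T, hT⟩ := exists_annihCoeff_bound (B ρ n f)
  rw [B_apply ρ m (f := B ρ n f) (N := T + (A + N)) fun j hj => (hT j (by omega)).1]
  have h1 : ∀ j ∈ Finset.range (T + (A + N)),
      creationCoeff ρ (m + j) * annihCoeff j (B ρ n f) =
      ∑ i ∈ Finset.range N, ∑ x ∈ antidiagonal j, kernelCoeff ρ x.1 •
        (creationCoeff ρ (m + x.1 + x.2) * creationCoeff ρ (n - x.1 + i) *
          annihCoeff x.2 (annihCoeff i f)) := by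
    intro j _
    rw [B_apply ρ n fun j hj => (hN j hj).1, map_sum, Finset.mul_sum]
    refine Finset.sum_congr rfl fun i _ => ?_
    rw [annihCoeff_mul, Finset.mul_sum]
    refine Finset.sum_congr rfl fun x hx => ?_
    rw [annihCoeff_creationCoeff, smul_mul_assoc, mul_smul_comm, mul_assoc,
      ← mem_antidiagonal.mp hx, show m + ((x.1 + x.2 : ℕ) : ℤ) = m + x.1 + x.2 by push_cast; ring,
      add_sub_right_comm]
  rw [Finset.sum_congr rfl h1, Finset.sum_comm]
  simp only [normalOrdered, Finset.smul_sum]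
  rw [Finset.sum_comm (s := Finset.range A)]
  refine Finset.sum_congr rfl fun i hi => sum_range_antidiagonal _ (by omega) fun x hx => ?_
  simp only [Finset.mem_range] at hi
  rw [not_and_or, not_lt, not_lt] at hx
  rcases hx with hx | hx
  · rw [creationCoeff_of_neg ρ (m := n - x.1 + i) (by omega)]
    simp
  · rw [(hN _ hx).2 i]
    simp

theorem B_comp_sub (ρ : K) (m n : ℤ) {f : Lam K} {N : ℕ}
    (hN : ∀ j, N ≤ j → annihCoeff j f = 0 ∧ ∀ i, annihCoeff j (annihCoeff i f) = 0) :
    B ρ m (B ρ n f) - ρ • B ρ (m + 1) (B ρ (n - 1) f) =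
      normalOrdered ρ N m n f - normalOrdered ρ N (m + 1) (n - 1) f := by
  rw [B_comp ρ m n (A := ((n + N).toNat + 1) + 1) hN (by omega),
    B_comp ρ (m + 1) (n - 1) (A := (n + N).toNat + 1) hN (by omega), Finset.sum_range_succ',
    Finset.smul_sum, add_sub_right_comm, ← Finset.sum_sub_distrib, Finset.sum_range_succ',
    Finset.sum_eq_zero]
  · simp only [kernelCoeff, Nat.cast_zero, zero_add, Nat.cast_one, add_zero, sub_zero, one_smul,
      pow_one, pow_zero]
    module
  · intro a _
    have e1 : m + ((a + 1 + 1 : ℕ) : ℤ) = m + 1 + ((a + 1 : ℕ) : ℤ) := by push_cast; ring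
    have e2 : n - ((a + 1 + 1 : ℕ) : ℤ) = n - 1 - ((a + 1 : ℕ) : ℤ) := by push_cast; ring
    rw [e1, e2, smul_smul, ← sub_smul]
    simp only [kernelCoeff]
    rw [show ρ ^ (a + 1 + 1) - ρ ^ (a + 1) - ρ * (ρ ^ (a + 1) - ρ ^ a) = 0 by ring, zero_smul]

/-- The exchange relation of the vertex operators. -/
theorem B_exchange (ρ : K) (m n : ℤ) :
    B ρ m * B ρ n + B ρ (n - 1) * B ρ (m + 1) =
      ρ • (B ρ (m + 1) * B ρ (n - 1) + B ρ n * B ρ m) := by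
  refine LinearMap.ext fun f => ?_
  obtain ⟨N, hN⟩ := exists_annihCoeff_bound f
  have h1 := B_comp_sub ρ m n hN
  have h2 := B_comp_sub ρ (n - 1) (m + 1) hN
  rw [sub_add_cancel, add_sub_cancel_right, normalOrdered_comm ρ N n m,
    normalOrdered_comm ρ N (n - 1)] at h2
  simp only [LinearMap.add_apply, LinearMap.smul_apply, Module.End.mul_apply, smul_add]
  linear_combination (exp := 1) h1 + h2

end Vertex

/-! ### A `q`-binomial theorem -/

section QBinomial

variable {K : Type*} [Field K]

theorem phi_succ (k : ℕ) (x : K) : phi (k + 1) x = phi k x * (1 - x ^ (k + 1)) := by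
  rw [phi, phi, Finset.prod_Icc_succ_top (by omega)]

theorem phi_zero (x : K) : phi 0 x = 1 := by simp [phi]

theorem phi_ne_zero {t : K} (ht : ∀ n : ℕ, 0 < n → t ^ n ≠ 1) (k : ℕ) : phi k t ≠ 0 := by
  refine Finset.prod_ne_zero_iff.mpr fun i hi => sub_ne_zero.mpr (Ne.symm (ht i ?_))
  simp only [Finset.mem_Icc] at hi
  omega

theorem one_sub_mul_inv_phi_succ {t : K} (ht : ∀ n : ℕ, 0 < n → t ^ n ≠ 1) (k : ℕ) :
    (1 - t ^ (k + 1)) * (phi (k + 1) t)⁻¹ = (phi k t)⁻¹ := by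
  have h := phi_ne_zero ht (k + 1)
  rw [phi_succ] at h ⊢
  have := left_ne_zero_of_mul h
  have := right_ne_zero_of_mul h
  field_simp

/-- If `X + Y` and `Y` commute up to the scalar `t`, the divided powers `(X + Y)^l / φ_l(t)` expand
as in the `q`-binomial theorem. -/
theorem qBinomial {A : Type*} [Ring A] [Algebra K A] {t : K} (ht : ∀ n : ℕ, 0 < n → t ^ n ≠ 1)
    {X Y : A} (h : (X + Y) * Y = t • (Y * (X + Y))) (l : ℕ) :
    (phi l t)⁻¹ • (X + Y) ^ l = ∑ x ∈ antidiagonal l,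
      (t ^ x.1.choose 2 * (phi x.1 t)⁻¹ * (phi x.2 t)⁻¹) • (Y ^ x.1 * X ^ x.2) := by
  have hpow : ∀ i : ℕ, (X + Y) * Y ^ i = t ^ i • (Y ^ i * (X + Y)) := by
    intro i
    induction i with
    | zero => simp
    | succ i ih =>
      rw [pow_succ, ← mul_assoc, ih, smul_mul_assoc, mul_assoc, h, mul_smul_comm, smul_smul,
        ← pow_succ, mul_assoc]
  induction l with
  | zero => simp [phi_zero]
  | succ l ih =>
    have hl : (1 - t ^ (l + 1)) ≠ 0 := sub_ne_zero.mpr (Ne.symm (ht _ l.succ_pos))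
    refine smul_right_injective _ hl ?_
    simp only
    rw [smul_smul, one_sub_mul_inv_phi_succ ht, pow_succ', ← mul_smul_comm, ih, Finset.mul_sum,
      Finset.smul_sum]
    -- `1 - t^{i+k} = t^i (1 - t^k) + (1 - t^i)` matches the two contributions to `Y^i X^k`
    have e1 : ∀ x ∈ antidiagonal l, (X + Y) *
        ((t ^ x.1.choose 2 * (phi x.1 t)⁻¹ * (phi x.2 t)⁻¹) • (Y ^ x.1 * X ^ x.2)) =
        (t ^ x.1 * (t ^ x.1.choose 2 * (phi x.1 t)⁻¹ * (phi x.2 t)⁻¹)) •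
          (Y ^ x.1 * X ^ (x.2 + 1)) +
        (t ^ x.1 * (t ^ x.1.choose 2 * (phi x.1 t)⁻¹ * (phi x.2 t)⁻¹)) •
          (Y ^ (x.1 + 1) * X ^ x.2) := by
      intro x _
      rw [mul_smul_comm, ← mul_assoc, hpow, smul_mul_assoc, smul_smul, ← smul_add, pow_succ' X,
        pow_succ Y]
      congr 1
      · ring
      · noncomm_ring
    have e2 : ∀ x ∈ antidiagonal (l + 1), (1 - t ^ (l + 1)) •
        ((t ^ x.1.choose 2 * (phi x.1 t)⁻¹ * (phi x.2 t)⁻¹) • (Y ^ x.1 * X ^ x.2)) =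
        (t ^ x.1 * (t ^ x.1.choose 2 * (phi x.1 t)⁻¹ * ((1 - t ^ x.2) * (phi x.2 t)⁻¹))) •
          (Y ^ x.1 * X ^ x.2) +
        (t ^ x.1.choose 2 * ((1 - t ^ x.1) * (phi x.1 t)⁻¹) * (phi x.2 t)⁻¹) •
          (Y ^ x.1 * X ^ x.2) := by
      intro x hx
      rw [smul_smul, ← add_smul, ← mem_antidiagonal.mp hx]
      congr 1
      ring
    rw [Finset.sum_congr rfl e1, Finset.sum_congr rfl e2, Finset.sum_add_distrib,
      Finset.sum_add_distrib, Finset.Nat.sum_antidiagonal_succ', Finset.Nat.sum_antidiagonal_succ]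
    simp only [pow_zero, sub_self, zero_mul, mul_zero, zero_smul, zero_add,
      one_sub_mul_inv_phi_succ ht]
    congr 1
    refine Finset.sum_congr rfl fun x _ => ?_
    congr 1
    rw [Nat.choose_succ_succ' x.1 1, Nat.choose_one_right, pow_add]
    ring

end QBinomial

/-! ### Truncated vertex series -/

section Truncated

variable {K : Type*} [Field K]

/-- The series `U_a(z) = ∑_{n ≥ 0} z^n B_{a+n}` with operator coefficients. -/
def truncB (ρ : K) (a : ℕ) : PowerSeries (Module.End K (Lam K)) :=
  PowerSeries.mk fun n => B ρ ((a + n : ℕ) : ℤ)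

theorem truncB_eq (ρ : K) (a : ℕ) :
    truncB ρ a = PowerSeries.C (B ρ a) + PowerSeries.X * truncB ρ (a + 1) := by
  ext n : 1
  cases n with
  | zero => simp [truncB]
  | succ n =>
    rw [map_add, PowerSeries.coeff_succ_X_mul, PowerSeries.coeff_C, if_neg n.succ_ne_zero, zero_add]
    simp only [truncB, PowerSeries.coeff_mk]
    congr 2
    ring

/-- The divided power `U_a(z)^l / φ_l(ρ)`, coefficient of `z^s`. -/
def truncBPow (ρ : K) (a l s : ℕ) : Module.End K (Lam K) :=
  (phi l ρ)⁻¹ • PowerSeries.coeff s (truncB ρ a ^ l)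

variable [CharZero K]

/-- Summed over all index pairs, the exchange relations become a `ρ`-commutation. -/
theorem truncB_exchange (ρ : K) (a : ℕ) :
    truncB ρ a * truncB ρ (a + 1) = ρ • (truncB ρ (a + 1) * truncB ρ a) := by
  ext s : 1
  rw [PowerSeries.coeff_smul, PowerSeries.coeff_mul, PowerSeries.coeff_mul]
  simp only [truncB, PowerSeries.coeff_mk]
  -- every term of either side occurs twice in the sum of the exchange relations
  set S := ∑ x ∈ antidiagonal s, B ρ ((a + x.1 : ℕ) : ℤ) * B ρ ((a + 1 + x.2 : ℕ) : ℤ) with hS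
  set T := ∑ x ∈ antidiagonal s, B ρ ((a + 1 + x.1 : ℕ) : ℤ) * B ρ ((a + x.2 : ℕ) : ℤ) with hT
  have hS' : S = ∑ x ∈ antidiagonal s, B ρ ((a + x.2 : ℕ) : ℤ) * B ρ ((a + 1 + x.1 : ℕ) : ℤ) := by
    rw [hS, ← Finset.Nat.sum_antidiagonal_swap]; rfl
  have hT' : T = ∑ x ∈ antidiagonal s, B ρ ((a + 1 + x.2 : ℕ) : ℤ) * B ρ ((a + x.1 : ℕ) : ℤ) := by
    rw [hT, ← Finset.Nat.sum_antidiagonal_swap]; rfl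
  have h : S + S = ρ • (T + T) := by
    nth_rw 2 [hS', hT']
    rw [hS, hT, ← Finset.sum_add_distrib, ← Finset.sum_add_distrib, Finset.smul_sum]
    refine Finset.sum_congr rfl fun x _ => ?_
    have := B_exchange ρ ((a + x.1 : ℕ) : ℤ) ((a + 1 + x.2 : ℕ) : ℤ)
    rw [show ((a + 1 + x.2 : ℕ) : ℤ) - 1 = ((a + x.2 : ℕ) : ℤ) by push_cast; ring,
      show ((a + x.1 : ℕ) : ℤ) + 1 = ((a + 1 + x.1 : ℕ) : ℤ) by push_cast; ring] at this
    exact this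
  rw [← two_smul K, ← two_smul K T, smul_comm] at h
  exact smul_right_injective _ (two_ne_zero' K) h

/-- The `q`-binomial theorem splits off the factors of the least index `a`. -/
theorem truncBPow_rec {ρ : K} (hρ : ∀ n : ℕ, 0 < n → ρ ^ n ≠ 1) (a l s : ℕ) :
    truncBPow ρ a l s = ∑ x ∈ antidiagonal l, if x.1 ≤ s then
      (ρ ^ x.1.choose 2 * (phi x.2 ρ)⁻¹) • (truncBPow ρ (a + 1) x.1 (s - x.1) * B ρ a ^ x.2)
      else 0 := by
  have hex : (PowerSeries.C (B ρ a) + PowerSeries.X * truncB ρ (a + 1)) *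
      (PowerSeries.X * truncB ρ (a + 1)) = ρ • ((PowerSeries.X * truncB ρ (a + 1)) *
      (PowerSeries.C (B ρ a) + PowerSeries.X * truncB ρ (a + 1))) := by
    rw [← truncB_eq, ← mul_assoc, ← PowerSeries.X_mul, mul_assoc, truncB_exchange, mul_smul_comm,
      mul_assoc]
  have h := congrArg (PowerSeries.coeff s) (qBinomial hρ hex l)
  rw [← truncB_eq, PowerSeries.coeff_smul, map_sum] at h
  rw [truncBPow, h]
  refine Finset.sum_congr rfl fun x _ => ?_
  rw [PowerSeries.coeff_smul, ← map_pow, PowerSeries.coeff_mul_C,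
    (PowerSeries.commute_X (truncB ρ (a + 1))).symm.mul_pow, PowerSeries.coeff_X_pow_mul']
  split_ifs
  · rw [truncBPow, smul_mul_assoc, smul_smul]
    congr 1
    ring
  · simp

theorem coeff_truncB_zero_pow_one (ρ : K) (k r : ℕ) :
    PowerSeries.coeff r (truncB ρ 0 ^ k) 1 = creationCoeff (ρ ^ k) r := by
  induction k generalizing r with
  | zero =>
    rw [pow_zero, pow_zero, PowerSeries.coeff_one]
    have h : creationSeries (1 : K) = 0 := by
      ext n : 1
      simp [coeff_creationSeries]
    rw [creationCoeff_natCast, h, psExp, PowerSeries.coeff_mk, Finset.sum_range_succ']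
    split_ifs with hr
    · simp [hr]
    · simp [PowerSeries.coeff_one, hr]
  | succ k ih =>
    rw [pow_succ', pow_succ', ← sum_B_creationCoeff, PowerSeries.coeff_mul, LinearMap.sum_apply]
    refine Finset.sum_congr rfl fun x _ => ?_
    rw [Module.End.mul_apply, ih, truncB, PowerSeries.coeff_mk, zero_add]

/-- The polynomial `∏_{i < l} (1 - ρ^{-i} Y)`. -/
def fallingPoly (ρ : K) (l : ℕ) : Polynomial (Lam K) :=
  ∏ i ∈ Finset.range l, (1 - Polynomial.C (C (ρ⁻¹ ^ i)) * Polynomial.X)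

omit [CharZero K] in
theorem eval_fallingPoly {ρ : K} (h0 : ρ ≠ 0) (hρ : ∀ n : ℕ, 0 < n → ρ ^ n ≠ 1) (l k : ℕ) :
    (fallingPoly ρ l).eval (C (ρ ^ k)) =
      C (if l ≤ k then phi k ρ * (phi (k - l) ρ)⁻¹ else 0) := by
  induction l with
  | zero => simp [fallingPoly, phi_ne_zero hρ]
  | succ l ih =>
    have e : fallingPoly ρ (l + 1) =
        fallingPoly ρ l * (1 - Polynomial.C (C (ρ⁻¹ ^ l)) * Polynomial.X) :=
      Finset.prod_range_succ _ _
    rw [e, Polynomial.eval_mul, ih]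
    simp only [Polynomial.eval_sub, Polynomial.eval_one, Polynomial.eval_mul, Polynomial.eval_C,
      Polynomial.eval_X]
    rw [← C_1, ← C_mul, ← C_sub, ← C_mul]
    congr 1
    rcases lt_trichotomy l k with h | h | h
    · rw [if_pos h.le, if_pos (show l + 1 ≤ k from h)]
      obtain ⟨d, rfl⟩ := Nat.exists_eq_add_of_lt h
      rw [show l + d + 1 - l = d + 1 by omega, show l + d + 1 - (l + 1) = d by omega,
        ← one_sub_mul_inv_phi_succ hρ d, add_assoc, pow_add, ← mul_assoc, ← mul_pow,
        inv_mul_cancel₀ h0, one_pow, one_mul]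
      ring
    · subst h
      rw [← mul_pow, inv_mul_cancel₀ h0, one_pow, sub_self, mul_zero, if_neg (by omega)]
    · rw [if_neg (by omega), if_neg (by omega), zero_mul]

omit [CharZero K] in
theorem phi_eq_prod_range (k : ℕ) (x : K) : phi k x = ∏ i ∈ Finset.range k, (1 - x ^ (i + 1)) := by
  induction k with
  | zero => simp [phi]
  | succ k ih => rw [phi_succ, ih, Finset.prod_range_succ]

omit [CharZero K] in
/-- The factor `1 - Y` is the one that vanishes at `Y = 1`. -/
theorem derivative_fallingPoly (ρ : K) (l : ℕ) :
    (Polynomial.derivative (fallingPoly ρ (l + 1))).eval 1 = -C (phi l ρ⁻¹) := by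
  rw [fallingPoly, Finset.prod_range_succ', Polynomial.derivative_mul]
  simp [Polynomial.eval_prod, phi_eq_prod_range]

/-- `exp (∑ (1 - Y^n) t_n z^n)` with `Y` an indeterminate, coefficient of `z^r`. -/
def creationPoly (K : Type*) [Field K] (r : ℕ) : Polynomial (Lam K) :=
  PowerSeries.coeff r (psExp (K := K)
    (PowerSeries.mk fun n => (1 - Polynomial.X ^ n) * Polynomial.C (tvar n)))

omit [CharZero K] in
theorem eval_creationPoly (y : K) (r : ℕ) : (creationPoly K r).eval (C y) = creationCoeff y r := by
  have h : PowerSeries.map (Polynomial.evalRingHom (C y : Lam K))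
      (PowerSeries.mk fun n => (1 - Polynomial.X ^ n) * Polynomial.C (tvar n)) =
      creationSeries y := by
    ext n : 1
    rw [PowerSeries.coeff_map, PowerSeries.coeff_mk, coeff_creationSeries, smul_eq_C_mul]
    simp
  rw [creationPoly, psExp, PowerSeries.coeff_mk, Polynomial.eval_finsetSum, creationCoeff_natCast,
    psExp, PowerSeries.coeff_mk]
  refine Finset.sum_congr rfl fun k _ => ?_
  rw [Polynomial.eval_smul, ← h, ← map_pow, PowerSeries.coeff_map]
  rfl

omit [CharZero K] in
theorem derivative_creationPoly (r : ℕ+) :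
    (Polynomial.derivative (creationPoly K r)).eval 1 = -(p r : Lam K) := by
  -- every coefficient of the exponent is divisible by `1 - Y`, so only its first power contributes
  set F1 : PowerSeries (Polynomial (Lam K)) := PowerSeries.mk fun n =>
    (∑ i ∈ Finset.range n, Polynomial.X ^ i) * Polynomial.C (tvar n) with hF1
  have hF : (PowerSeries.mk fun n => (1 - Polynomial.X ^ n) * Polynomial.C (tvar n)) =
      PowerSeries.C (1 - Polynomial.X : Polynomial (Lam K)) * F1 := by
    ext n : 1
    rw [PowerSeries.coeff_C_mul, hF1, PowerSeries.coeff_mk, PowerSeries.coeff_mk, ← mul_assoc,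
      mul_neg_geom_sum]
  rw [creationPoly, psExp, PowerSeries.coeff_mk, hF, Polynomial.derivative_sum,
    Polynomial.eval_finsetSum, Finset.sum_eq_single 1]
  · rw [Polynomial.derivative_smul, Polynomial.eval_smul, pow_one, PowerSeries.coeff_C_mul,
      Polynomial.derivative_mul, hF1, PowerSeries.coeff_mk]
    simp [Polynomial.eval_finsetSum, p, tvar, smul_eq_C_mul]
    exact Or.inl rfl
  · intro k _ hk
    rw [Polynomial.derivative_smul, Polynomial.eval_smul, mul_pow, ← map_pow,
      PowerSeries.coeff_C_mul, Polynomial.derivative_mul, Polynomial.derivative_pow]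
    rcases Nat.eq_zero_or_pos k with h | h
    · subst h
      simp [PowerSeries.coeff_one]
    · simp [zero_pow (show k - 1 ≠ 0 by omega), zero_pow (show k ≠ 0 by omega)]
  · intro h
    have := r.pos
    simp only [Finset.mem_range] at h
    omega

omit [CharZero K] in
theorem pow_injective_of_not_root {t : K} (h0 : t ≠ 0) (ht : ∀ n : ℕ, 0 < n → t ^ n ≠ 1) :
    Function.Injective fun k : ℕ => t ^ k := by
  have key : ∀ i j : ℕ, i < j → t ^ i ≠ t ^ j := by
    intro i j hij h
    obtain ⟨d, rfl⟩ := Nat.exists_eq_add_of_lt hij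
    rw [add_assoc, pow_add] at h
    exact ht (d + 1) d.succ_pos (mul_left_cancel₀ (pow_ne_zero i h0) (by rw [← h, mul_one]))
  intro i j h
  by_contra hne
  rcases lt_or_gt_of_ne hne with hij | hij
  · exact key i j hij h
  · exact key j i hij h.symm

/-- The expansion in `Y` is checked at the infinitely many points `Y = ρ^k`, where the left side is
`U_0(z)^k · 1`. -/
theorem creationPoly_eq {ρ : K} (h0 : ρ ≠ 0) (hρ : ∀ n : ℕ, 0 < n → ρ ^ n ≠ 1) (r : ℕ) :
    creationPoly K r = ∑ l ∈ Finset.range (r + 1),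
      Polynomial.C (ρ ^ l.choose 2 • truncBPow ρ 1 l (r - l) 1) * fallingPoly ρ l := by
  refine Polynomial.eq_of_infinite_eval_eq _ _ (Set.Infinite.mono ?_
    (Set.infinite_range_of_injective ((C_injective ℕ+ K).comp (pow_injective_of_not_root h0 hρ))))
  rintro _ ⟨k, rfl⟩
  simp only [Function.comp_apply, Set.mem_ofPred_eq]
  rw [eval_creationPoly, ← coeff_truncB_zero_pow_one, Polynomial.eval_finsetSum]
  simp only [Polynomial.eval_mul, Polynomial.eval_C, eval_fallingPoly h0 hρ]
  have h1 : PowerSeries.coeff r (truncB ρ 0 ^ k) = phi k ρ • truncBPow ρ 0 k r := by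
    rw [truncBPow, smul_smul, mul_inv_cancel₀ (phi_ne_zero hρ k), one_smul]
  have hB : ∀ j : ℕ, (B ρ ((0 : ℕ) : ℤ) ^ j) (1 : Lam K) = 1 := by
    intro j
    induction j with
    | zero => simp
    | succ j ih =>
      rw [pow_succ, Module.End.mul_apply, B_one,
        show creationCoeff ρ ((0 : ℕ) : ℤ) = 1 from creationCoeff_zero ρ, ih]
  rw [h1, LinearMap.smul_apply, truncBPow_rec hρ, LinearMap.sum_apply, Finset.smul_sum]
  rw [Finset.Nat.sum_antidiagonal_eq_sum_range_succ_mk]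
  -- the two sums run over `l ≤ k` and `l ≤ r`; only `l ≤ min k r` contributes to either
  set f : ℕ → Lam K := fun l => if l ≤ k ∧ l ≤ r then
    (phi k ρ * (phi (k - l) ρ)⁻¹ * ρ ^ l.choose 2) • truncBPow ρ 1 l (r - l) 1 else 0 with hf
  have e1 : ∀ N, min k r ≤ N →
      ∑ l ∈ Finset.range (min k r + 1), f l = ∑ l ∈ Finset.range (N + 1), f l := by
    intro N hN
    refine Finset.sum_subset (Finset.range_mono (by omega)) fun l _ hl => ?_
    simp only [Finset.mem_range] at hl
    rw [hf]
    simp only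
    rw [if_neg (by omega)]
  refine Eq.trans (Finset.sum_congr rfl fun l hl => ?_)
    ((e1 k (min_le_left _ _)).symm.trans ((e1 r (min_le_right _ _)).trans
      (Finset.sum_congr rfl fun l hl => ?_)))
  · simp only [Finset.mem_range] at hl
    simp only [hf]
    by_cases h : l ≤ r
    · rw [if_pos h, if_pos ⟨by omega, h⟩, LinearMap.smul_apply, Module.End.mul_apply, hB, smul_smul]
      congr 1
      ring
    · rw [if_neg h, if_neg (by omega)]
      simp
  · simp only [Finset.mem_range] at hl
    simp only [hf]
    by_cases h : l ≤ k
    · rw [if_pos h, if_pos ⟨h, by omega⟩]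
      simp only [smul_eq_C_mul, C_mul]
      ring
    · rw [if_neg h, if_neg (by omega)]
      simp

/-- The power sum is minus the derivative of `exp (∑ (1 - Y^n) t_n z^n)` at `Y = 1`. -/
theorem p_eq_sum_truncBPow {ρ : K} (h0 : ρ ≠ 0) (hρ : ∀ n : ℕ, 0 < n → ρ ^ n ≠ 1) (r : ℕ+) :
    (p r : Lam K) = ∑ l ∈ Finset.Icc 1 (r : ℕ),
      (phi (l - 1) ρ⁻¹ * ρ ^ l.choose 2) • truncBPow ρ 1 l (r - l) 1 := by
  have h := congrArg (fun q => (Polynomial.derivative q).eval 1) (creationPoly_eq h0 hρ r)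
  rw [derivative_creationPoly, Polynomial.derivative_sum, Polynomial.eval_finsetSum,
    Finset.sum_range_succ'] at h
  have hz : (Polynomial.derivative (Polynomial.C (ρ ^ (0 : ℕ).choose 2 •
      truncBPow ρ 1 0 (r - 0) (1 : Lam K)) * fallingPoly ρ 0)).eval 1 = 0 := by
    simp [fallingPoly]
  rw [hz, add_zero] at h
  rw [← neg_neg (p r : Lam K), h, ← Finset.sum_neg_distrib, Finset.range_eq_Ico,
    Finset.sum_Ico_add' (fun l => -(Polynomial.derivative (Polynomial.C (ρ ^ l.choose 2 •
      truncBPow ρ 1 l (r - l) (1 : Lam K)) * fallingPoly ρ l)).eval 1)]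
  refine Finset.sum_congr (by ext; simp) fun l hl => ?_
  simp only [Finset.mem_Icc] at hl
  obtain ⟨l, rfl⟩ := Nat.exists_eq_add_of_le' hl.1
  rw [Polynomial.derivative_C_mul, Polynomial.eval_mul, derivative_fallingPoly, Polynomial.eval_C,
    Nat.add_sub_cancel]
  simp only [smul_eq_C_mul, C_mul]
  ring

end Truncated

/-! ### Collecting the truncated series by partitions -/

section Multisets

/-- The statistic `∑ (i - 1) μ_i` of a list, with positions counted from `1` (so the factor is the
index of the entry counted from `0`). -/
def listStat (L : List ℕ) : ℕ := ∑ i : Fin L.length, (i : ℕ) * L.get i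

theorem listStat_eq_sum_range (L : List ℕ) :
    listStat L = ∑ i ∈ Finset.range L.length, i * L.getD i 0 := by
  rw [listStat, Finset.sum_range]
  exact Finset.sum_congr rfl fun i _ => by simp

/-- Appending `k` copies of `a` adds `a (m + (m + 1) + ⋯ + (m + k - 1))`, where `m` is the length of
`L`. -/
theorem listStat_append_replicate (L : List ℕ) (k a : ℕ) :
    listStat (L ++ List.replicate k a) + a * L.length.choose 2 =
      listStat L + a * (L.length + k).choose 2 := by
  have h : ∀ n, ∑ i ∈ Finset.range n, i = n.choose 2 := fun n => by
    rw [Finset.sum_range_id, Nat.choose_two_right]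
  rw [listStat_eq_sum_range, listStat_eq_sum_range, List.length_append, List.length_replicate,
    Finset.sum_range_add, ← h, ← h, Finset.sum_range_add, add_assoc, mul_add, add_comm (a * _)]
  congr 1
  · refine Finset.sum_congr rfl fun i hi => ?_
    rw [List.getD_append _ _ _ _ (by simpa using hi)]
  · congr 1
    rw [Finset.mul_sum]
    refine Finset.sum_congr rfl fun i hi => ?_
    rw [List.getD_append_right _ _ _ _ (by omega), Nat.add_sub_cancel_left,
      List.getD_replicate _ (by simpa using hi), mul_comm]

theorem sort_add_replicate {ν : Multiset ℕ} {a : ℕ} (h : ∀ x ∈ ν, a + 1 ≤ x) (k : ℕ) :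
    (ν + Multiset.replicate k a).sort (· ≥ ·) = ν.sort (· ≥ ·) ++ List.replicate k a := by
  refine List.Perm.eq_of_pairwise' (r := (· ≥ ·)) (Multiset.pairwise_sort _ _) ?_ ?_
  · rw [List.pairwise_append]
    refine ⟨Multiset.pairwise_sort _ _, ?_, fun x hx y hy => ?_⟩
    · exact List.pairwise_replicate.mpr (Or.inr le_rfl)
    · rw [List.eq_of_mem_replicate hy]
      have := h x ((Multiset.mem_sort _).mp hx)
      omega
  · rw [← Multiset.coe_eq_coe, Multiset.sort_eq, ← Multiset.coe_add, Multiset.sort_eq,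
      Multiset.coe_replicate]

/-- The multisets of `l` integers `≥ a` with sum `n`, as part multisets of partitions of `n`. -/
def partsFinset (n a l : ℕ) : Finset (Multiset ℕ) :=
  ((Finset.univ : Finset n.Partition).image fun μ => μ.parts).filter
    fun μ => Multiset.card μ = l ∧ ∀ x ∈ μ, a ≤ x

theorem mem_partsFinset {n a l : ℕ} (ha : 0 < a) {μ : Multiset ℕ} :
    μ ∈ partsFinset n a l ↔ μ.sum = n ∧ Multiset.card μ = l ∧ ∀ x ∈ μ, a ≤ x := by
  simp only [partsFinset, Finset.mem_filter, Finset.mem_image, Finset.mem_univ, true_and]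
  constructor
  · rintro ⟨⟨ν, rfl⟩, h⟩
    exact ⟨ν.parts_sum, h⟩
  · rintro ⟨h1, h2⟩
    exact ⟨⟨⟨μ, fun {i} hi => by have := h2.2 i hi; omega, h1⟩, rfl⟩, h2⟩

theorem filter_add_replicate_count {μ : Multiset ℕ} {a : ℕ} (h : ∀ x ∈ μ, a ≤ x) :
    μ.filter (a < ·) + Multiset.replicate (μ.count a) a = μ := by
  conv_rhs => rw [← Multiset.filter_add_not (a < ·) μ]
  rw [← Multiset.filter_eq']
  congr 1
  refine Multiset.filter_congr fun x hx => ?_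
  have := h x hx
  omega

/-- Splitting off the parts equal to the least admissible value `a`. -/
theorem sum_partsFinset {M : Type*} [AddCommMonoid M] (F : Multiset ℕ → M) {n a l : ℕ}
    (ha : 0 < a) : ∑ μ ∈ partsFinset n a l, F μ = ∑ x ∈ antidiagonal l,
      ∑ ν ∈ partsFinset (n - a * x.2) (a + 1) x.1,
        if a * x.2 ≤ n then F (ν + Multiset.replicate x.2 a) else 0 := by
  rw [← Finset.sum_fiberwise_of_maps_to (t := antidiagonal l)
    (g := fun μ => (l - μ.count a, μ.count a))]
  · refine Finset.sum_congr rfl ?_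
    rintro ⟨i, k⟩ hx
    have hx := mem_antidiagonal.mp hx
    simp only at hx ⊢
    have hμ : ∀ μ ∈ (partsFinset n a l).filter fun μ => (l - μ.count a, μ.count a) = (i, k),
        μ.filter (a < ·) + Multiset.replicate k a = μ ∧ (μ.filter (a < ·)).sum + a * k = n ∧
          Multiset.card (μ.filter (a < ·)) = i := by
      intro μ hμ
      rw [Finset.mem_filter, mem_partsFinset ha, Prod.mk.injEq] at hμ
      obtain ⟨⟨h1, h2, h3⟩, h4, h5⟩ := hμ
      have h6 := filter_add_replicate_count h3
      rw [h5] at h6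
      have h7 := congrArg Multiset.sum h6
      have h8 := congrArg Multiset.card h6
      rw [Multiset.sum_add, Multiset.sum_replicate, smul_eq_mul, h1, mul_comm] at h7
      rw [Multiset.card_add, Multiset.card_replicate, h2] at h8
      exact ⟨h6, h7, by omega⟩
    by_cases hn : a * k ≤ n
    · simp only [if_pos hn]
      refine Finset.sum_nbij' (fun μ => μ.filter (a < ·)) (fun ν => ν + Multiset.replicate k a)
        ?_ ?_ ?_ ?_ ?_
      · intro μ h
        obtain ⟨-, h2, h3⟩ := hμ μ h
        refine (mem_partsFinset a.succ_pos).mpr ⟨by omega, h3, fun x hx => ?_⟩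
        exact (Multiset.mem_filter.mp hx).2
      · intro ν h
        obtain ⟨h1, h2, h3⟩ := (mem_partsFinset a.succ_pos).mp h
        have hν : ν.count a = 0 :=
          Multiset.count_eq_zero.mpr fun hm => by have := h3 a hm; omega
        rw [Finset.mem_filter, mem_partsFinset ha, Multiset.sum_add, Multiset.card_add,
          Multiset.sum_replicate, Multiset.card_replicate, Multiset.count_add,
          Multiset.count_replicate_self, hν, smul_eq_mul, mul_comm k]
        refine ⟨⟨by omega, by omega, fun x hx => ?_⟩, by simp only [Prod.mk.injEq]; omega⟩
        rcases Multiset.mem_add.mp hx with hx | hx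
        · have := h3 x hx
          omega
        · exact (Multiset.eq_of_mem_replicate hx).ge
      · intro μ h
        exact (hμ μ h).1
      · intro ν h
        obtain ⟨h1, h2, h3⟩ := (mem_partsFinset a.succ_pos).mp h
        have h4 : ν.filter (a < ·) = ν := Multiset.filter_eq_self.mpr fun x hx => h3 x hx
        simp only [Multiset.filter_add]
        rw [h4, Multiset.filter_eq_nil.mpr, add_zero]
        intro x hx
        rw [Multiset.eq_of_mem_replicate hx]
        exact lt_irrefl _
      · intro μ h
        rw [(hμ μ h).1]
    · simp only [if_neg hn, Finset.sum_const_zero]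
      refine Finset.sum_eq_zero fun μ h => absurd (hμ μ h).2.1 (by omega)
  · intro μ hμ
    have h := (mem_partsFinset ha).mp hμ
    have := Multiset.count_le_card a μ
    exact mem_antidiagonal.mpr (by simp only; omega)

variable {K : Type*} [Field K]

/-- `b_μ(x)` for a multiset `μ` of parts. -/
def multisetB (μ : Multiset ℕ) (x : K) : K := ∏ i ∈ μ.toFinset, phi (μ.count i) x

theorem multisetB_add_replicate {ν : Multiset ℕ} {a : ℕ} (h : ∀ x ∈ ν, a + 1 ≤ x) (k : ℕ) (x : K) :
    multisetB (ν + Multiset.replicate k a) x = multisetB ν x * phi k x := by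
  have hν : a ∉ ν := fun ha => by have := h a ha; omega
  rcases Nat.eq_zero_or_pos k with hk | hk
  · simp [hk, phi_zero]
  rw [multisetB, Multiset.toFinset_add, Multiset.toFinset_replicate, if_neg hk.ne',
    Finset.union_comm, ← Finset.insert_eq, Finset.prod_insert (by simpa using hν), mul_comm,
    multisetB]
  congr 1
  · refine Finset.prod_congr rfl fun i hi => ?_
    have : i ≠ a := fun e => hν (by simpa [e] using hi)
    rw [Multiset.count_add, Multiset.count_replicate, if_neg (Ne.symm this), add_zero]
  · simp [Multiset.count_eq_zero.mpr hν]

/-- The product `B_{μ₁} B_{μ₂} ⋯` over the parts in decreasing order. -/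
def multisetOp (ρ : K) (μ : Multiset ℕ) : Module.End K (Lam K) :=
  ((μ.sort (· ≥ ·)).map fun n : ℕ => B ρ (n : ℤ)).prod

theorem multisetOp_add_replicate (ρ : K) {ν : Multiset ℕ} {a : ℕ} (h : ∀ x ∈ ν, a + 1 ≤ x)
    (k : ℕ) : multisetOp ρ (ν + Multiset.replicate k a) = multisetOp ρ ν * B ρ a ^ k := by
  rw [multisetOp, sort_add_replicate h, List.map_append, List.prod_append, List.map_replicate,
    List.prod_replicate, multisetOp]

variable [CharZero K]

/-- The coefficients of `U_a(z)^l / φ_l(ρ)` as sums over the partitions with `l` parts, all of them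
at least `a`. The prefactor `ρ^{a l(l-1)/2}` is the share of `ρ^{n(μ)}` that comes from the common
value `a` contained in every part. -/
theorem truncBPow_eq_sum {ρ : K} (hρ : ∀ n : ℕ, 0 < n → ρ ^ n ≠ 1) {a : ℕ} (ha : 0 < a)
    (l s : ℕ) : ρ ^ (a * l.choose 2) • truncBPow ρ a l s =
      ∑ μ ∈ partsFinset (s + a * l) a l,
        (ρ ^ listStat (μ.sort (· ≥ ·)) * (multisetB μ ρ)⁻¹) • multisetOp ρ μ := by
  -- downward induction on `a`: when `a` exceeds the total degree only `l = s = 0` contributes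
  obtain ⟨d, hd⟩ : ∃ d, s + a * l + 1 ≤ a + d := ⟨s + a * l + 1, by omega⟩
  induction d generalizing a l s with
  | zero =>
    have hl : l = 0 := by
      rcases Nat.eq_zero_or_pos l with h | h
      · exact h
      · have := Nat.le_mul_of_pos_right a h
        omega
    subst hl
    rw [truncBPow, pow_zero, PowerSeries.coeff_one, phi_zero]
    simp only [mul_zero, add_zero, Nat.choose_zero_succ, pow_zero, one_smul, inv_one]
    split_ifs with hs
    · rw [Finset.sum_eq_single 0]
      · simp [multisetB, multisetOp, show listStat [] = 0 from rfl]
      · intro μ hμ h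
        exact absurd (Multiset.card_eq_zero.mp ((mem_partsFinset ha).mp hμ).2.1) h
      · intro h
        exact absurd ((mem_partsFinset ha).mpr (by simp [hs])) h
    · refine (Finset.sum_eq_zero fun μ hμ => ?_).symm
      obtain ⟨h1, h2, -⟩ := (mem_partsFinset ha).mp hμ
      rw [Multiset.card_eq_zero.mp h2, Multiset.sum_zero] at h1
      exact absurd h1.symm hs
  | succ d ih =>
    rw [truncBPow_rec hρ, sum_partsFinset _ ha, Finset.smul_sum]
    refine Finset.sum_congr rfl fun x hx => ?_
    have hx := mem_antidiagonal.mp hx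
    have hn : s + a * l - a * x.2 = s + a * x.1 := by
      rw [← hx, mul_add]; omega
    have hn' : a * x.2 ≤ s + a * l := by rw [← hx, mul_add]; omega
    rw [hn]
    simp only [if_pos hn']
    by_cases hs : x.1 ≤ s
    · rw [if_pos hs]
      have hsum : s + a * x.1 = s - x.1 + (a + 1) * x.1 := by rw [add_mul, one_mul]; omega
      have h1 := ih (Nat.succ_pos a) x.1 (s - x.1) (by rw [← hsum]; omega)
      rw [← hsum] at h1
      have hexp : a * l.choose 2 + x.1.choose 2 =
          (a * l.choose 2 - a * x.1.choose 2) + (a + 1) * x.1.choose 2 := by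
        have : a * x.1.choose 2 ≤ a * l.choose 2 :=
          Nat.mul_le_mul_left a (Nat.choose_le_choose 2 (by omega))
        rw [add_mul, one_mul]
        omega
      rw [smul_smul, ← mul_assoc, ← pow_add, hexp, pow_add, mul_right_comm, ← smul_smul,
        ← smul_mul_assoc, h1, Finset.sum_mul, Finset.smul_sum]
      refine Finset.sum_congr rfl fun ν hν => ?_
      obtain ⟨-, h2, h3⟩ := (mem_partsFinset a.succ_pos).mp hν
      have h4 := listStat_append_replicate (ν.sort (· ≥ ·)) x.2 a
      rw [← sort_add_replicate h3, Multiset.length_sort, h2, hx] at h4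
      have h5 : a * x.1.choose 2 ≤ a * l.choose 2 :=
        Nat.mul_le_mul_left a (Nat.choose_le_choose 2 (by omega))
      rw [multisetB_add_replicate h3, multisetOp_add_replicate ρ h3, smul_mul_assoc, smul_smul,
        show listStat ((ν + Multiset.replicate x.2 a).sort (· ≥ ·)) =
          (a * l.choose 2 - a * x.1.choose 2) + listStat (ν.sort (· ≥ ·)) by omega, pow_add,
        mul_inv]
      congr 1
      ring
    · rw [if_neg hs, smul_zero]
      refine (Finset.sum_eq_zero fun ν hν => ?_).symm
      -- the parts of `ν` exceed `a`, so their sum is at least `(a + 1) * x.1 > s + a * x.1`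
      obtain ⟨h1, h2, h3⟩ := (mem_partsFinset a.succ_pos).mp hν
      have h4 := Multiset.card_nsmul_le_sum h3
      rw [h1, h2, smul_eq_mul, Nat.mul_succ, mul_comm] at h4
      omega

end Multisets

/-! ### The expansion of the power sum and the multiplication rule -/

section Generic

variable {K : Type*} [Field K]

theorem bStat_eq_multisetB {r : ℕ} (μ : r.Partition) (x : K) : bStat μ x = multisetB μ.parts x := by
  refine (Finset.prod_subset (fun i hi => ?_) fun i _ hi => ?_).symm
  · have hi := Multiset.mem_toFinset.mp hi
    have h1 := μ.parts_pos hi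
    have h2 := Multiset.le_sum_of_mem hi
    rw [μ.parts_sum] at h2
    exact Finset.mem_Icc.mpr ⟨h1, h2⟩
  · rw [Multiset.count_eq_zero.mpr (fun h => hi (Multiset.mem_toFinset.mpr h)), phi_zero]

theorem length_partsList {r : ℕ} (μ : r.Partition) : (partsList μ).length = μ.parts.card :=
  Multiset.length_sort _

theorem Q_partsList (ρ : K) {r : ℕ} (μ : r.Partition) :
    Q ρ ((partsList μ).map (Nat.cast : ℕ → ℤ)) = multisetOp ρ μ.parts 1 := by
  rw [Q, List.map_map]
  rfl

variable [CharZero K]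

/-- The power sum `p_r` in terms of Hall-Littlewood polynomials. -/
theorem p_eq_sum_Q {ρ : K} (h0 : ρ ≠ 0) (hρ : ∀ n : ℕ, 0 < n → ρ ^ n ≠ 1) (r : ℕ+) :
    (p r : Lam K) = ∑ μ : (r : ℕ).Partition,
      c μ ρ • Q ρ ((partsList μ).map (Nat.cast : ℕ → ℤ)) := by
  rw [p_eq_sum_truncBPow h0 hρ, ← Finset.sum_fiberwise_of_maps_to (t := Finset.Icc 1 (r : ℕ))
    (g := fun μ : (r : ℕ).Partition => μ.parts.card)]
  · refine Finset.sum_congr rfl fun l hl => ?_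
    rw [Finset.mem_Icc] at hl
    have h := truncBPow_eq_sum hρ one_pos l (r - l)
    rw [one_mul, one_mul, Nat.sub_add_cancel hl.2] at h
    rw [← smul_smul, ← LinearMap.smul_apply, h, LinearMap.sum_apply, Finset.smul_sum]
    refine (Finset.sum_nbij (fun μ : (r : ℕ).Partition => μ.parts) ?_ ?_ ?_ ?_).symm
    · intro μ hμ
      exact (mem_partsFinset one_pos).mpr
        ⟨μ.parts_sum, (Finset.mem_filter.mp hμ).2, fun x hx => μ.parts_pos hx⟩
    · intro μ _ ν _ h
      exact Nat.Partition.ext h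
    · intro M hM
      obtain ⟨h1, h2, h3⟩ := (mem_partsFinset one_pos).mp hM
      exact ⟨⟨M, fun {i} hi => h3 i hi, h1⟩, by simpa using h2, rfl⟩
    · intro μ hμ
      rw [Q_partsList, LinearMap.smul_apply, smul_smul, c, bStat_eq_multisetB, length_partsList,
        (Finset.mem_filter.mp hμ).2, div_eq_mul_inv]
      congr 1
      change _ = phi (l - 1) ρ⁻¹ * (ρ ^ nStat μ * (multisetB μ.parts ρ)⁻¹)
      ring
  · intro μ _
    rw [Finset.mem_Icc]
    have h1 : μ.parts.card • 1 ≤ μ.parts.sum :=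
      Multiset.card_nsmul_le_sum fun x hx => μ.parts_pos hx
    rw [μ.parts_sum, smul_eq_mul, mul_one] at h1
    refine ⟨Multiset.card_pos.mpr fun h => ?_, h1⟩
    have h2 := μ.parts_sum
    rw [h, Multiset.sum_zero] at h2
    exact r.ne_zero h2.symm

/-- `p_mul_B` iterated along a product of vertex operators. -/
theorem p_mul_prod_B (ρ : K) (r : ℕ+) (f : Lam K) {l : ℕ} (lam : Fin l → ℤ) :
    p r * ((List.ofFn lam).map (B ρ)).prod f =
      (∑ i : Fin l, ((List.ofFn (lam + Pi.single i ((r : ℕ) : ℤ))).map (B ρ)).prod f) +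
        ((List.ofFn lam).map (B ρ)).prod (p r * f) := by
  induction l with
  | zero => simp
  | succ l ih =>
    simp only [List.ofFn_succ, List.map_cons, List.prod_cons, Module.End.mul_apply]
    rw [p_mul_B, ih, Fin.sum_univ_succ, map_add, map_sum]
    have e0 : ∀ i : Fin l, (lam + Pi.single 0 ((r : ℕ) : ℤ) : Fin (l + 1) → ℤ) i.succ =
        lam i.succ := fun i => by simp
    have e1 : ∀ i : Fin l, (lam + Pi.single i.succ ((r : ℕ) : ℤ) : Fin (l + 1) → ℤ) 0 =
        lam 0 := fun i => by simp
    have e2 : ∀ i j : Fin l, (lam + Pi.single i.succ ((r : ℕ) : ℤ) : Fin (l + 1) → ℤ) j.succ =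
        ((fun k : Fin l => lam k.succ) + Pi.single i ((r : ℕ) : ℤ) : Fin l → ℤ) j :=
      fun i j => by simp [Pi.single_apply]
    simp only [e0, e1, e2]
    rw [Pi.add_apply, Pi.single_eq_same]
    abel

/-- The multiplication rule follows from its case `l = 0`. -/
theorem p_mul_Q_of_p_eq (ρ : K) (r : ℕ+) (d : (r : ℕ).Partition → K)
    (h : (p r : Lam K) = ∑ μ : (r : ℕ).Partition,
      d μ • Q ρ ((partsList μ).map (Nat.cast : ℕ → ℤ))) {l : ℕ} (lam : Fin l → ℤ) :
    p r * Q ρ (List.ofFn lam) =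
      (∑ i : Fin l, Q ρ (List.ofFn (lam + Pi.single i ((r : ℕ) : ℤ)))) +
      ∑ μ : (r : ℕ).Partition, d μ •
        Q ρ (List.ofFn lam ++ (partsList μ).map (Nat.cast : ℕ → ℤ)) := by
  have h1 := p_mul_prod_B ρ r 1 lam
  rw [mul_one] at h1
  rw [Q, h1]
  congr 1
  rw [h, map_sum]
  refine Finset.sum_congr rfl fun μ _ => ?_
  rw [map_smul, Q, Q, List.map_append, List.prod_append, Module.End.mul_apply]

end Generic

/-! ### Regularity of the coefficients `c_μ` -/

section Regular

/-- The rational functions without a pole at `z`. -/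
def regularAt (z : ℂ) : Subring (RatFunc ℂ) where
  carrier := {a | a.denom.eval z ≠ 0}
  mul_mem' := by
    intro a b ha hb h
    have h1 := Polynomial.eval_dvd (x := z) (RatFunc.denom_mul_dvd a b)
    rw [h, zero_dvd_iff, Polynomial.eval_mul] at h1
    exact mul_ne_zero ha hb h1
  one_mem' := by simp
  add_mem' := by
    intro a b ha hb h
    have h1 := Polynomial.eval_dvd (x := z) (RatFunc.denom_add_dvd a b)
    rw [h, zero_dvd_iff, Polynomial.eval_mul] at h1
    exact mul_ne_zero ha hb h1
  zero_mem' := by simp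
  neg_mem' := by
    intro a ha h
    have h1 := Polynomial.eval_dvd (x := z) (RatFunc.denom_mul_dvd (-1) a)
    have h2 : (-1 : RatFunc ℂ) = RatFunc.C (-1) := by simp
    rw [neg_one_mul, h, zero_dvd_iff, Polynomial.eval_mul, h2, RatFunc.denom_C,
      Polynomial.eval_one, one_mul] at h1
    exact ha h1

theorem C_mem_regularAt (z a : ℂ) : RatFunc.C a ∈ regularAt z := by
  change (RatFunc.C a).denom.eval z ≠ 0
  simp

theorem X_mem_regularAt (z : ℂ) : RatFunc.X ∈ regularAt z := by
  change (RatFunc.X : RatFunc ℂ).denom.eval z ≠ 0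
  simp

theorem inv_one_sub_X_pow_mem_regularAt {z : ℂ} {m : ℕ} (h : z ^ m ≠ 1) :
    (1 - RatFunc.X ^ m : RatFunc ℂ)⁻¹ ∈ regularAt z := by
  change ((1 - RatFunc.X ^ m : RatFunc ℂ)⁻¹).denom.eval z ≠ 0
  intro h0
  have h1 := Polynomial.eval_dvd (x := z)
    (RatFunc.denom_div_dvd (1 : Polynomial ℂ) (1 - Polynomial.X ^ m))
  rw [map_one, map_sub, map_one, map_pow, RatFunc.algebraMap_X, one_div, h0, zero_dvd_iff] at h1
  simp only [Polynomial.eval_sub, Polynomial.eval_one, Polynomial.eval_pow,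
    Polynomial.eval_X] at h1
  exact h (sub_eq_zero.mp h1).symm

variable {K : Type*} [Field K]

/-- Gaussian binomial coefficients are polynomials, by the `q`-Pascal rule. -/
theorem phi_add_div_mem (S : Subring K) {t : K} (htS : t ∈ S) (ht : ∀ n : ℕ, 0 < n → t ^ n ≠ 1)
    (a b : ℕ) : phi (a + b) t * (phi a t)⁻¹ * (phi b t)⁻¹ ∈ S := by
  induction a generalizing b with
  | zero => simp [phi_zero, phi_ne_zero ht b, S.one_mem]
  | succ a iha =>
    induction b with
    | zero => simp [phi_zero, phi_ne_zero ht (a + 1), S.one_mem]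
    | succ b ihb =>
      -- `1 - t^{a+b+2} = (1 - t^{a+1}) + t^{a+1} (1 - t^{b+1})`
      have e : phi (a + 1 + (b + 1)) t * (phi (a + 1) t)⁻¹ * (phi (b + 1) t)⁻¹ =
          phi (a + (b + 1)) t * (phi a t)⁻¹ * (phi (b + 1) t)⁻¹ +
          t ^ (a + 1) * (phi (a + 1 + b) t * (phi (a + 1) t)⁻¹ * (phi b t)⁻¹) := by
        rw [← one_sub_mul_inv_phi_succ ht a, ← one_sub_mul_inv_phi_succ ht b, ← add_assoc,
          phi_succ (a + 1 + b), show a + (b + 1) = a + 1 + b by omega]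
        ring
      rw [e]
      exact S.add_mem (iha _) (S.mul_mem (S.pow_mem htS _) ihb)

/-- Gaussian multinomial coefficients are polynomials. -/
theorem phi_sum_div_prod_mem (S : Subring K) {t : K} (htS : t ∈ S)
    (ht : ∀ n : ℕ, 0 < n → t ^ n ≠ 1) (T : Finset ℕ) (m : ℕ → ℕ) :
    phi (∑ i ∈ T, m i) t * (∏ i ∈ T, phi (m i) t)⁻¹ ∈ S := by
  classical
  induction T using Finset.induction_on with
  | empty => simp [phi_zero, S.one_mem]
  | insert i T hi ih =>
    rw [Finset.sum_insert hi, Finset.prod_insert hi]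
    have e : phi (m i + ∑ j ∈ T, m j) t * (phi (m i) t * ∏ j ∈ T, phi (m j) t)⁻¹ =
        (phi (m i + ∑ j ∈ T, m j) t * (phi (m i) t)⁻¹ * (phi (∑ j ∈ T, m j) t)⁻¹) *
        (phi (∑ j ∈ T, m j) t * (∏ j ∈ T, phi (m j) t)⁻¹) := by
      have := phi_ne_zero ht (∑ j ∈ T, m j)
      field_simp
    rw [e]
    exact S.mul_mem (phi_add_div_mem S htS ht _ _) ih

/-- The power `ρ^{n(μ)}` suffices to clear the denominator of `φ_{l(μ)-1}(ρ⁻¹)`. -/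
theorem choose_two_le_listStat (L : List ℕ) (h : ∀ x ∈ L, 0 < x) :
    L.length.choose 2 ≤ listStat L := by
  rw [Nat.choose_two_right, ← Finset.sum_range_id, Finset.sum_range, listStat]
  exact Finset.sum_le_sum fun i _ => Nat.le_mul_of_pos_right _ (h _ (List.get_mem L i))

/-- Clearing the negative powers of `t` in `φ_k(t⁻¹)`. -/
theorem pow_choose_mul_phi_inv {t : K} (h0 : t ≠ 0) (k : ℕ) :
    t ^ (k + 1).choose 2 * phi k t⁻¹ = (-1) ^ k * phi k t := by
  induction k with
  | zero => simp [phi_zero]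
  | succ k ih =>
    have e : t ^ (k + 1) * (1 - t⁻¹ ^ (k + 1)) = -(1 - t ^ (k + 1)) := by
      rw [mul_sub, ← mul_pow, mul_inv_cancel₀ h0]
      ring
    rw [Nat.choose_succ_succ' (k + 1) 1, Nat.choose_one_right, phi_succ, phi_succ, pow_add,
      pow_succ (-1 : K) k]
    linear_combination (t ^ (k + 1) * (1 - t⁻¹ ^ (k + 1))) * ih + (-1) ^ k * phi k t * e

theorem ratFunc_X_pow_ne_one (n : ℕ) (hn : 0 < n) : (RatFunc.X : RatFunc ℂ) ^ n ≠ 1 := by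
  intro h
  rw [← RatFunc.algebraMap_X, ← map_pow, ← map_one (algebraMap (Polynomial ℂ) (RatFunc ℂ))] at h
  have h1 := congrArg Polynomial.natDegree (RatFunc.algebraMap_injective ℂ h)
  rw [Polynomial.natDegree_X_pow, Polynomial.natDegree_one] at h1
  omega

/-- If `z^r ≠ 1`, some multiplicity `m_i(μ)` has `z^{m_i} ≠ 1`; the factor `1 - ρ^{m_i}` of `b_μ` is
then invertible at `z`, and the rest of `c_μ` is a Gaussian multinomial coefficient. -/
theorem cGeneric_mem_regularAt {r : ℕ} {z : ℂ} (hz : z ^ r ≠ 1) (μ : r.Partition) :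
    cGeneric μ ∈ regularAt z := by
  obtain ⟨i, hi, hzi⟩ : ∃ i ∈ μ.parts.toFinset, z ^ μ.parts.count i ≠ 1 := by
    by_contra! h
    apply hz
    have h1 := Finset.sum_multiset_count μ.parts
    rw [μ.parts_sum] at h1
    rw [h1, ← Finset.prod_pow_eq_pow_sum]
    refine Finset.prod_eq_one fun i hi => ?_
    rw [smul_eq_mul, pow_mul, h i hi, one_pow]
  have hX := ratFunc_X_pow_ne_one
  have hX0 : (RatFunc.X : RatFunc ℂ) ≠ 0 := RatFunc.X_ne_zero
  have hcount : 0 < μ.parts.count i := Multiset.count_pos.mpr (Multiset.mem_toFinset.mp hi)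
  have hcard := Multiset.toFinset_sum_count_eq μ.parts
  have hle := Multiset.count_le_card i μ.parts
  obtain ⟨m, hm⟩ : ∃ m, μ.parts.count i = m + 1 := ⟨μ.parts.count i - 1, by omega⟩
  set T := μ.parts.toFinset.erase i with hT
  have hsum : m + ∑ j ∈ T, μ.parts.count j = μ.parts.card - 1 := by
    rw [← hcard, ← Finset.add_sum_erase _ _ hi, hm, ← hT]
    omega
  have hn : (μ.parts.card - 1 + 1).choose 2 ≤ nStat μ := by
    rw [Nat.sub_add_cancel (by omega), ← length_partsList]
    exact choose_two_le_listStat _ fun x hx => μ.parts_pos ((Multiset.mem_sort _).mp hx)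
  obtain ⟨d, hd⟩ := Nat.exists_eq_add_of_le hn
  have e : cGeneric μ = RatFunc.X ^ d * (-1) ^ (μ.parts.card - 1) *
      (1 - RatFunc.X ^ (m + 1))⁻¹ *
      (phi (m + ∑ j ∈ T, μ.parts.count j) RatFunc.X * (phi m RatFunc.X)⁻¹ *
        (phi (∑ j ∈ T, μ.parts.count j) RatFunc.X)⁻¹) *
      (phi (∑ j ∈ T, μ.parts.count j) RatFunc.X *
        (∏ j ∈ T, phi (μ.parts.count j) RatFunc.X)⁻¹) := by
    have h1 := phi_ne_zero hX (∑ j ∈ T, μ.parts.count j)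
    rw [hsum, cGeneric, c, bStat_eq_multisetB, multisetB, ← Finset.mul_prod_erase _ _ hi, hm,
      ← hT, phi_succ, hd, length_partsList, pow_add, mul_right_comm, pow_choose_mul_phi_inv hX0]
    field_simp
  rw [e]
  have hXS := X_mem_regularAt z
  refine Subring.mul_mem _ (Subring.mul_mem _ (Subring.mul_mem _ (Subring.mul_mem _
    (Subring.pow_mem _ hXS _) (Subring.pow_mem _ (Subring.neg_mem _ (Subring.one_mem _)) _)) ?_)
    (phi_add_div_mem _ hXS hX _ _)) (phi_sum_div_prod_mem _ hXS hX _ _)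
  rw [← hm]
  exact inv_one_sub_X_pow_mem_regularAt hzi

end Regular

/-! ### Specialization -/

section Specialization

/-- `a` is regular at `z` and takes the value `b` there. -/
def SpecializesTo (z : ℂ) (a : RatFunc ℂ) (b : ℂ) : Prop :=
  a ∈ regularAt z ∧ a.eval (RingHom.id ℂ) z = b

variable {z : ℂ}

theorem SpecializesTo.add {a a' : RatFunc ℂ} {b b' : ℂ} (h : SpecializesTo z a b)
    (h' : SpecializesTo z a' b') : SpecializesTo z (a + a') (b + b') :=
  ⟨Subring.add_mem _ h.1 h'.1, by rw [RatFunc.eval_add (RingHom.id ℂ) z h.1 h'.1, h.2, h'.2]⟩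

theorem SpecializesTo.mul {a a' : RatFunc ℂ} {b b' : ℂ} (h : SpecializesTo z a b)
    (h' : SpecializesTo z a' b') : SpecializesTo z (a * a') (b * b') :=
  ⟨Subring.mul_mem _ h.1 h'.1, by rw [RatFunc.eval_mul (RingHom.id ℂ) z h.1 h'.1, h.2, h'.2]⟩

theorem specializesTo_C (b : ℂ) : SpecializesTo z (RatFunc.C b) b :=
  ⟨C_mem_regularAt z b, by simp⟩

theorem specializesTo_zero : SpecializesTo z 0 0 := by
  simpa using specializesTo_C (z := z) 0

theorem specializesTo_one : SpecializesTo z 1 1 := by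
  simpa using specializesTo_C (z := z) 1

theorem specializesTo_natCast (n : ℕ) : SpecializesTo z n n := by
  simpa using specializesTo_C (z := z) n

theorem specializesTo_inv_natCast (n : ℕ) : SpecializesTo z (n : RatFunc ℂ)⁻¹ (n : ℂ)⁻¹ := by
  simpa using specializesTo_C (z := z) (n : ℂ)⁻¹

theorem specializesTo_X : SpecializesTo z RatFunc.X z :=
  ⟨X_mem_regularAt z, by simp⟩

theorem SpecializesTo.pow {a : RatFunc ℂ} {b : ℂ} (h : SpecializesTo z a b) (n : ℕ) :
    SpecializesTo z (a ^ n) (b ^ n) := by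
  induction n with
  | zero => simpa using specializesTo_one
  | succ n ih => simpa only [pow_succ] using ih.mul h

theorem SpecializesTo.sum {ι : Type*} (s : Finset ι) {a : ι → RatFunc ℂ} {b : ι → ℂ}
    (h : ∀ i ∈ s, SpecializesTo z (a i) (b i)) :
    SpecializesTo z (∑ i ∈ s, a i) (∑ i ∈ s, b i) := by
  classical
  induction s using Finset.induction_on with
  | empty => simpa using specializesTo_zero
  | insert i s hi ih =>
    rw [Finset.sum_insert hi, Finset.sum_insert hi]
    exact (h i (Finset.mem_insert_self _ _)).add
      (ih fun j hj => h j (Finset.mem_insert_of_mem hj))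

/-- Coefficientwise specialization of polynomials in the `t_n`. -/
def PolySpecializesTo (z : ℂ) (f : Lam (RatFunc ℂ)) (g : Lam ℂ) : Prop :=
  ∀ s, SpecializesTo z (coeff s f) (coeff s g)

variable {f f' : Lam (RatFunc ℂ)} {g g' : Lam ℂ}

theorem PolySpecializesTo.unique (h : PolySpecializesTo z f g) (h' : PolySpecializesTo z f g') :
    g = g' := by
  ext s
  rw [← (h s).2, (h' s).2]

theorem PolySpecializesTo.mul (h : PolySpecializesTo z f g) (h' : PolySpecializesTo z f' g') :
    PolySpecializesTo z (f * f') (g * g') := by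
  classical
  intro s
  rw [coeff_mul, coeff_mul]
  exact SpecializesTo.sum _ fun x _ => (h x.1).mul (h' x.2)

theorem PolySpecializesTo.smul {a : RatFunc ℂ} {b : ℂ} (hab : SpecializesTo z a b)
    (h : PolySpecializesTo z f g) : PolySpecializesTo z (a • f) (b • g) := by
  intro s
  rw [coeff_smul, coeff_smul]
  exact hab.mul (h s)

theorem PolySpecializesTo.sum {ι : Type*} (s : Finset ι) {f : ι → Lam (RatFunc ℂ)}
    {g : ι → Lam ℂ} (h : ∀ i ∈ s, PolySpecializesTo z (f i) (g i)) :
    PolySpecializesTo z (∑ i ∈ s, f i) (∑ i ∈ s, g i) := by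
  intro m
  rw [coeff_sum, coeff_sum]
  exact SpecializesTo.sum _ fun i hi => h i hi m

theorem polySpecializesTo_zero : PolySpecializesTo z 0 0 := fun s => by
  simpa using specializesTo_zero

theorem polySpecializesTo_one : PolySpecializesTo z 1 1 := fun s => by
  classical
  rw [coeff_one, coeff_one]
  split_ifs
  · exact specializesTo_one
  · exact specializesTo_zero

theorem polySpecializesTo_X (n : ℕ+) : PolySpecializesTo z (X n) (X n) := fun s => by
  classical
  rw [coeff_X, coeff_X]
  split_ifs
  · exact specializesTo_one
  · exact specializesTo_zero

theorem polySpecializesTo_p (r : ℕ+) : PolySpecializesTo z (p r) (p r) :=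
  (polySpecializesTo_X r).smul (specializesTo_natCast _)

theorem PolySpecializesTo.annih (h : PolySpecializesTo z f g) (n : ℕ+) :
    PolySpecializesTo z (annih n f) (annih n g) := by
  intro s
  have e : ∀ {K : Type} [Field K] (f : Lam K), coeff s (HallLittlewood.annih n f) =
      ((n : ℕ) : K)⁻¹ * (coeff (s + Finsupp.single n 1) f * ((s n : K) + 1)) := by
    intro K _ f
    simp [HallLittlewood.annih, coeff_pderiv]
  rw [e, e]
  exact (specializesTo_inv_natCast _).mul
    ((h _).mul ((specializesTo_natCast _).add specializesTo_one))

theorem polySpecializesTo_creationCoeff (m : ℤ) :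
    PolySpecializesTo z (creationCoeff RatFunc.X m) (creationCoeff z m) := by
  rcases lt_or_ge m 0 with hm | hm
  · rw [creationCoeff_of_neg _ hm, creationCoeff_of_neg _ hm]
    exact polySpecializesTo_zero
  lift m to ℕ using hm
  have h1 : ∀ n, PolySpecializesTo z (PowerSeries.coeff n (creationSeries RatFunc.X))
      (PowerSeries.coeff n (creationSeries z)) := by
    intro n
    rw [creationSeries, creationSeries, PowerSeries.coeff_mk, PowerSeries.coeff_mk]
    split_ifs
    · refine (polySpecializesTo_X _).smul ?_
      have := specializesTo_one.add ((specializesTo_C (-1)).mul (specializesTo_X (z := z) |>.pow n))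
      simpa [sub_eq_add_neg] using this
    · exact polySpecializesTo_zero
  have h2 : ∀ k n, PolySpecializesTo z (PowerSeries.coeff n (creationSeries RatFunc.X ^ k))
      (PowerSeries.coeff n (creationSeries z ^ k)) := by
    intro k
    induction k with
    | zero =>
      intro n
      rw [pow_zero, pow_zero, PowerSeries.coeff_one, PowerSeries.coeff_one]
      split_ifs
      · exact polySpecializesTo_one
      · exact polySpecializesTo_zero
    | succ k ih =>
      intro n
      rw [pow_succ, pow_succ, PowerSeries.coeff_mul, PowerSeries.coeff_mul]
      exact PolySpecializesTo.sum _ fun x _ => (ih _).mul (h1 _)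
  rw [creationCoeff_natCast, creationCoeff_natCast, psExp, psExp, PowerSeries.coeff_mk,
    PowerSeries.coeff_mk]
  exact PolySpecializesTo.sum _ fun k _ => (h2 k m).smul (specializesTo_inv_natCast _)

theorem PolySpecializesTo.annihCoeff (h : PolySpecializesTo z f g) (j : ℕ) :
    PolySpecializesTo z (annihCoeff j f) (annihCoeff j g) := by
  have h2 : ∀ (k n : ℕ) {f : Lam (RatFunc ℂ)} {g : Lam ℂ}, PolySpecializesTo z f g →
      PolySpecializesTo z (PowerSeries.coeff n (annihSeries (K := RatFunc ℂ) ^ k) f)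
        (PowerSeries.coeff n (annihSeries (K := ℂ) ^ k) g) := by
    intro k
    induction k with
    | zero =>
      intro n f g h
      rw [pow_zero, pow_zero, PowerSeries.coeff_one, PowerSeries.coeff_one]
      split_ifs
      · exact h
      · exact polySpecializesTo_zero
    | succ k ih =>
      intro n f g h
      rw [pow_succ, pow_succ, PowerSeries.coeff_mul, PowerSeries.coeff_mul, LinearMap.sum_apply,
        LinearMap.sum_apply]
      refine PolySpecializesTo.sum _ fun x _ => ih _ ?_
      rw [annihSeries, annihSeries, PowerSeries.coeff_mk, PowerSeries.coeff_mk]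
      split_ifs
      · have := (h.annih ⟨x.2, by assumption⟩).smul (specializesTo_C (-1))
        simpa using this
      · exact polySpecializesTo_zero
  rw [HallLittlewood.annihCoeff, HallLittlewood.annihCoeff, psExp, psExp, PowerSeries.coeff_mk,
    PowerSeries.coeff_mk, LinearMap.sum_apply, LinearMap.sum_apply]
  exact PolySpecializesTo.sum _ fun k _ => (h2 k j h).smul (specializesTo_inv_natCast _)

theorem PolySpecializesTo.B (h : PolySpecializesTo z f g) (m : ℤ) :
    PolySpecializesTo z (B RatFunc.X m f) (B z m g) := by
  obtain ⟨N, hN⟩ := exists_annihCoeff_bound f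
  obtain ⟨N', hN'⟩ := exists_annihCoeff_bound g
  rw [B_apply _ m (f := f) (N := N + N') fun j hj => (hN j (by omega)).1,
    B_apply _ m (f := g) (N := N + N') fun j hj => (hN' j (by omega)).1]
  exact PolySpecializesTo.sum _ fun j _ =>
    (polySpecializesTo_creationCoeff _).mul (h.annihCoeff j)

theorem polySpecializesTo_Q (L : List ℤ) : PolySpecializesTo z (Q RatFunc.X L) (Q z L) := by
  induction L with
  | nil => exact polySpecializesTo_one
  | cons m L ih =>
    rw [Q, Q, List.map_cons, List.prod_cons, List.map_cons, List.prod_cons]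
    exact ih.B m

end Specialization

end

end HallLittlewood

open HallLittlewood in
theorem mainTheorem3 (r : ℕ+) (l : ℕ) (lam : Fin l → ℤ) :
    -- the identity over `ℂ(ρ)`, with `ρ` an indeterminate
    (p r * Q (RatFunc.X : RatFunc ℂ) (List.ofFn lam) =
      (∑ i : Fin l, Q (RatFunc.X : RatFunc ℂ) (List.ofFn (lam + Pi.single i ((r : ℕ) : ℤ)))) +
      ∑ μ : (r : ℕ).Partition, c μ (RatFunc.X : RatFunc ℂ) •
        Q (RatFunc.X : RatFunc ℂ) (List.ofFn lam ++ (partsList μ).map (Nat.cast : ℕ → ℤ))) ∧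
    -- the identity at every complex `ρ` with `ρ ^ r ≠ 1`, where each `c μ` is regular
    (∀ ρ : ℂ, ρ ^ (r : ℕ) ≠ 1 →
      (∀ μ : (r : ℕ).Partition, (cGeneric μ).denom.eval ρ ≠ 0) ∧
      p r * Q ρ (List.ofFn lam) =
        (∑ i : Fin l, Q ρ (List.ofFn (lam + Pi.single i ((r : ℕ) : ℤ)))) +
        ∑ μ : (r : ℕ).Partition, (cGeneric μ).eval (RingHom.id ℂ) ρ •
          Q ρ (List.ofFn lam ++ (partsList μ).map (Nat.cast : ℕ → ℤ))) := by
  have hp := p_eq_sum_Q RatFunc.X_ne_zero ratFunc_X_pow_ne_one r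
  refine ⟨p_mul_Q_of_p_eq _ r _ hp lam, fun ρ hρ => ⟨fun μ => cGeneric_mem_regularAt hρ μ,
    p_mul_Q_of_p_eq _ r _ ?_ lam⟩⟩
  have h := polySpecializesTo_p (z := ρ) r
  rw [hp] at h
  have h' := polySpecializesTo_p (z := ρ) r
  exact h.unique (PolySpecializesTo.sum _ fun μ _ =>
    (polySpecializesTo_Q _).smul ⟨cGeneric_mem_regularAt hρ μ, rfl⟩)
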